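/- Let $d\in\mathbb{N}$ and let $\rho_0\neq\rho_1$ be two distinct quantum states on $\mathbb{C}^d$ (positive semidefinite $d\times d$ matrices of trace $1$), both with full support (all eigenvalues strictly positive). A sequential quantum hypothesis test $\mathcal{S}=(\mathcal{X},\{\mu_k,d_k\}_{k\ge1},T)$ consists of a finite outcome set $\mathcal{X}$, conditional probability measures $\mu_k(\mathrm{d}m_k\mid x_1^{k-1},m_1^{k-1})$ on the set $\mathcal{M}_{\mathcal{X}}$ of POVMs $m=\{m(x)\}_{x\in\mathcal{X}}$ on $\mathbb{C}^d$, and measurable decision functions $d_k(x_1^k,m_1^k)\in\{0,1,*\}$; $T=\inf\{k\ge 1: d_k\neq *\}\in\mathbb{N}\cup\{\infty\}$. If the unknown state is $\rho$, the law $\mathbb{P}_{\mathcal{S},\rho}$ of the sequence $(M_k,X_k)_{k\ge1}$ of POVMs and outcomes is given by $$\mathbb{P}_{\mathcal{S},\rho}\big[M_1^k\in A,\;X_1^k=x_1^k\big]=\int_A\prod_{j=1}^k\mu_j(\mathrm{d}m_j\mid x_1^{j-1},m_1^{j-1})\,\mathrm{Tr}[\rho\, m_j(x_j)].$$ Let $0<\varepsilon<1$.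 A pair $(R_0,R_1)$ of positive real numbers is called $\varepsilon$-achievable under the probabilistic constraint if there is a sequence of sequential tests $\mathcal{S}_n$ (with outcome sets and strategies that may depend on $n$) such that, with $\mathbb{P}_{n,i}=\mathbb{P}_{\mathcal{S}_n,\rho_i}$, $\alpha_n=\mathbb{P}_{n,0}(T_n<\infty,\,d_{T_n}=1)$ and $\beta_n=\mathbb{P}_{n,1}(T_n<\infty,\,d_{T_n}=0)$, $$\liminf_{n\to\infty}\frac1n\log\frac1{\alpha_n}\ge R_0,\qquad \liminf_{n\to\infty}\frac1n\log\frac1{\beta_n}\ge R_1,\qquad \limsup_{n\to\infty}\max_{i\in\{0,1\}}\mathbb{P}_{n,i}(T_n>n)<\varepsilon .$$ Let $\mathcal{A}_{\mathrm P}(\varepsilon)\subset\mathbb{R}^2$ be the closure of the set of all $\varepsilon$-achievable pairs. Let $$D_{\mathcal M}(\rho\|\sigma)=\sup_m\sum_{x=1}^d \mathrm{Tr}[\rho\, m(x)]\log\frac{\mathrm{Tr}[\rho\, m(x)]}{\mathrm{Tr}[\sigma\, m(x)]}$$ be the measured relative entropy, where the supremum is over all projector-valued measures $m=\{m(x)\}_{x=1}^d$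 on $\mathbb{C}^d$ that consist of $d$ rank-one projectors. Then, for every $0<\varepsilon<1$, $$\mathcal{A}_{\mathrm P}(\varepsilon)=\big[0,\,D_{\mathcal M}(\rho_1\|\rho_0)\big]\times\big[0,\,D_{\mathcal M}(\rho_0\|\rho_1)\big].$$ In particular, the region does not depend on $\varepsilon$ (strong converse). -/

import Mathlib

open MeasureTheory ProbabilityTheory Filter
open scoped ENNReal ComplexOrder

noncomputable section

namespace QuantumSHT

/-- Quantum states on `ℂ^d`: positive semidefinite matrices of unit trace. -/
def State (d : ℕ) : Type :=
  {ρ : Matrix (Fin d) (Fin d) ℂ // ρ.PosSemidef ∧ ρ.trace = 1}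

/-- A state has full support if its matrix is positive definite
(all eigenvalues are strictly positive). -/
def State.FullSupport {d : ℕ} (ρ : State d) : Prop := ρ.1.PosDef

/-- POVMs on `ℂ^d` with outcomes in the finite set `𝒳`. -/
def POVM (d : ℕ) (𝒳 : Type) [Fintype 𝒳] : Type :=
  {m : 𝒳 → Matrix (Fin d) (Fin d) ℂ // (∀ x, (m x).PosSemidef) ∧ ∑ x, m x = 1}

/-- The Euclidean topology on the set of POVMs. -/
instance {d : ℕ} {𝒳 : Type} [Fintype 𝒳] : TopologicalSpace (POVM d 𝒳) :=
  instTopologicalSpaceSubtype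

/-- The Borel `σ`-algebra on the set of POVMs. -/
instance {d : ℕ} {𝒳 : Type} [Fintype 𝒳] : MeasurableSpace (POVM d 𝒳) := borel _

instance {d : ℕ} {𝒳 : Type} [Fintype 𝒳] : BorelSpace (POVM d 𝒳) := ⟨rfl⟩

/-- A rank-one projector-valued measure. -/
def POVM.IsRankOnePVM {d : ℕ} {𝒳 : Type} [Fintype 𝒳] (m : POVM d 𝒳) : Prop :=
  ∀ x, m.1 x * m.1 x = m.1 x ∧ (m.1 x).rank = 1

/-- Born's rule: the probability `Tr[ρ m(x)]` of the outcome `x`. -/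
def born {d : ℕ} {𝒳 : Type} [Fintype 𝒳] (ρ : State d) (m : POVM d 𝒳) (x : 𝒳) : ℝ :=
  ((ρ.1 * m.1 x).trace).re

/-- Classical relative entropy `∑ₓ P(x) log (P(x) / Q(x))` on a finite set (for strictly
positive `Q`, with `0 log 0 = 0`). -/
def relEntropy {𝒳 : Type} [Fintype 𝒳] (P Q : 𝒳 → ℝ) : ℝ :=
  ∑ x, P x * Real.log (P x / Q x)

/-- Measured relative entropy: the supremum of the relative entropies of the outcome
distributions over all rank-one PVMs that consist of `d` projectors. (For full-support states
the supremum is over a nonempty bounded set of reals.) -/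
def measuredRelEntropy {d : ℕ} (ρ σ : State d) : ℝ :=
  ⨆ m : {m : POVM d (Fin d) // m.IsRankOnePVM}, relEntropy (born ρ m.1) (born σ m.1)

lemma born_nonneg {d : ℕ} {𝒳 : Type} [Fintype 𝒳] (ρ : State d) (m : POVM d 𝒳) (x : 𝒳) :
    0 ≤ born ρ m x := by
  obtain ⟨B, hB⟩ : ∃ B : Matrix (Fin d) (Fin d) ℂ, m.1 x = B.conjTranspose * B := by
    open scoped MatrixOrder in
    exact CStarAlgebra.nonneg_iff_eq_star_mul_self.1 (m.2.1 x).nonneg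
  have h : (ρ.1 * m.1 x).trace = (B * ρ.1 * B.conjTranspose).trace := by
    rw [hB, ← Matrix.mul_assoc, Matrix.trace_mul_comm, ← Matrix.mul_assoc]
  have h2 := (ρ.2.1.mul_mul_conjTranspose_same B).trace_nonneg
  rw [born, h]
  exact (Complex.le_def.1 h2).1

lemma sum_born {d : ℕ} {𝒳 : Type} [Fintype 𝒳] (ρ : State d) (m : POVM d 𝒳) :
    ∑ x, born ρ m x = 1 := by
  simp only [born]
  rw [← Complex.re_sum, ← Matrix.trace_sum, ← Matrix.mul_sum, m.2.2, Matrix.mul_one, ρ.2.2,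
    Complex.one_re]

lemma continuous_born {d : ℕ} {𝒳 : Type} [Fintype 𝒳] (ρ : State d) (x : 𝒳) :
    Continuous fun m : POVM d 𝒳 => born ρ m x := by
  have h1 : Continuous fun m : POVM d 𝒳 => m.1 x :=
    (continuous_apply x).comp continuous_subtype_val
  exact Complex.continuous_re.comp (continuous_const.matrix_mul h1).matrix_trace

/-- The conditional law of the outcome given the POVM, as a Markov kernel: the outcome `x` has
probability `Tr[ρ m(x)]`. -/
def bornKernel {d N : ℕ} (ρ : State d) : Kernel (POVM d (Fin N)) (Fin N) where
  toFun m := ∑ x, ENNReal.ofReal (born ρ m x) • Measure.dirac x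
  measurable' := by
    refine Measure.measurable_of_measurable_coe _ fun s hs => ?_
    simp only [Measure.coe_finsetSum, Finset.sum_apply, Measure.smul_apply, smul_eq_mul]
    exact Finset.measurable_fun_sum _ fun x _ =>
      ((continuous_born ρ x).measurable.ennreal_ofReal).mul_const _

instance {d N : ℕ} (ρ : State d) : IsMarkovKernel (bornKernel (N := N) ρ) := by
  refine ⟨fun m => ⟨?_⟩⟩
  change (∑ x, ENNReal.ofReal (born ρ m x) • Measure.dirac x : Measure (Fin N)) Set.univ = 1
  simp only [Measure.coe_finsetSum, Finset.sum_apply, Measure.smul_apply, smul_eq_mul,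
    measure_univ, mul_one]
  rw [← ENNReal.ofReal_sum_of_nonneg fun x _ => born_nonneg ρ m x, sum_born, ENNReal.ofReal_one]

/-- The record of the first `k + 1` rounds, i.e. the POVMs and outcomes `(m_j, x_j)` of the
rounds `j = 0, …, k` (rounds are counted from `0`). -/
abbrev History (d N k : ℕ) : Type := Finset.Iic k → POVM d (Fin N) × Fin N

/-- A sequential (adaptive) quantum hypothesis test. Rounds are counted from `0`, so that
round `k` consumes the `(k+1)`-st copy of the state. -/
structure SQHT (d : ℕ) where
  /-- The number of measurement outcomes; the finite outcome set is `Fin N`. -/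
  N : ℕ
  /-- The law of the first POVM. -/
  first : Measure (POVM d (Fin N))
  isProb_first : IsProbabilityMeasure first
  /-- The conditional law of the POVM of round `k + 1` given the rounds `0, …, k`. -/
  next : (k : ℕ) → Kernel (History d N k) (POVM d (Fin N))
  isMarkov_next : ∀ k, IsMarkovKernel (next k)
  /-- The decision taken after round `k`, as a function of the rounds `0, …, k`: `none` means
  that the test continues, `some i` that it stops and declares the `i`-th hypothesis. -/
  rule : (k : ℕ) → History d N k → Option (Fin 2)
  measurable_rule : ∀ k a, MeasurableSet (rule k ⁻¹' {a})

attribute [instance] SQHT.isProb_first SQHT.isMarkov_next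

namespace SQHT

variable {d : ℕ} (S : SQHT d)

/-- The sample space of infinite sequences of POVMs and outcomes. -/
abbrev Path : Type := ℕ → POVM d (Fin S.N) × Fin S.N

/-- The law `P_{S,ρ}` of the sequence of POVMs and outcomes, when the test is run (forever) on
copies of the state `ρ`: in each round the POVM is drawn according to the strategy, and then
the outcome according to Born's rule. -/
def law (ρ : State d) : Measure S.Path :=
  Kernel.trajMeasure (X := fun _ => POVM d (Fin S.N) × Fin S.N)
    (S.first ⊗ₘ bornKernel ρ)
    (fun k => S.next k ⊗ₖ (bornKernel ρ).prodMkLeft (History d S.N k))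

/-- The decision after round `k` along a path. -/
def decision (k : ℕ) (ω : S.Path) : Option (Fin 2) :=
  S.rule k (fun j => ω j)

/-- The number `T` of copies that the test uses, i.e. the first time at which it does not
continue (`⊤` if it never stops). -/
def numCopies (ω : S.Path) : ℕ∞ :=
  ⨅ (k : ℕ) (_ : S.decision k ω ≠ none), ((k + 1 : ℕ) : ℕ∞)

/-- The event that the test stops and declares the `i`-th hypothesis, `d_T = i`. -/
def declares (i : Fin 2) : Set S.Path :=
  {ω | ∃ k : ℕ, S.numCopies ω = ((k + 1 : ℕ) : ℕ∞) ∧ S.decision k ω = some i}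

end SQHT

/-- `(R₀, R₁)` is an `ε`-achievable error exponent pair under the probabilistic constraint:
both rates are positive, and some sequence of tests `S n` has error probabilities
`αₙ = P_{n,0}(d_T = 1)` and `βₙ = P_{n,1}(d_T = 0)` with `liminf (1/n) log (1/αₙ) ≥ R₀`,
`liminf (1/n) log (1/βₙ) ≥ R₁` and `limsup max_i P_{n,i}(Tₙ > n) < ε`. -/
def IsAchievableProb {d : ℕ} (ε : ℝ) (ρ₀ ρ₁ : State d) (R : ℝ × ℝ) : Prop :=
  0 < R.1 ∧ 0 < R.2 ∧ ∃ S : ℕ → SQHT d,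
    (R.1 : EReal) ≤
      liminf (fun n : ℕ => ENNReal.log (1 / (S n).law ρ₀ ((S n).declares 1)) / (n : EReal)) atTop ∧
    (R.2 : EReal) ≤
      liminf (fun n : ℕ => ENNReal.log (1 / (S n).law ρ₁ ((S n).declares 0)) / (n : EReal)) atTop ∧
    limsup (fun n : ℕ => max ((S n).law ρ₀ {ω | (n : ℕ∞) < (S n).numCopies ω})
      ((S n).law ρ₁ {ω | (n : ℕ∞) < (S n).numCopies ω})) atTop < ENNReal.ofReal ε

/-- The error exponent region under the `ε`-probabilistic constraint: the closure in the plane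
of the set of `ε`-achievable pairs. -/
def regionProb {d : ℕ} (ε : ℝ) (ρ₀ ρ₁ : State d) : Set (ℝ × ℝ) :=
  closure {R | IsAchievableProb ε ρ₀ ρ₁ R}

end QuantumSHT

end

noncomputable section

namespace QuantumSHT

/-! ### Linear algebra of measurements -/

section LinearAlgebra

variable {d : ℕ}

/-! Everything is governed by the log-likelihood ratio of the record. It is a sum over rounds whose
terms are bounded uniformly over all POVMs, because each full-support state dominates a multiple of
the other. Under ρ, and for a given POVM, a term has mean equal to the relative entropy of the
outcome laws.

General POVMs (`relEntropy_le_measuredRelEntropy`). Tests may use any POVM M, while the measured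
relative entropy only sees rank-one projective measurements. With the likelihood ratios b_x put A =
∑ b_x M_x. Then Tr[σA] = 1, operator concavity of the logarithm gives ∑ Tr[ρM_x] log b_x ≤ Tr[ρ log
A], and Gibbs' inequality bounds the right side by the relative entropy of the measurement in an
eigenbasis of A. So under ρ no round has drift above D = `measuredRelEntropy ρ σ`.

Converse (`le_measuredRelEntropy_of_liminf`). Fix c > D. An adaptive Chernoff bound makes it
exponentially unlikely under ρ that the ratio after n rounds reaches nc. Below nc, a change of
measure costs a factor at most e^{nc}. If a wrong declaration under σ had exponent above c, the same
declaration made by time n would thus have vanishing probability under ρ. The opposite declaration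
is an error under ρ and also vanishes, as its rate is positive. Hence P_ρ(T > n) tends to 1, which
contradicts ε < 1 for every such ε.

Achievability (`isAchievableProb_of_lt`). A first phase of fixed length guesses the hypothesis; then
a nearly optimal measurement for that guess is repeated, and at time n a hypothesis is declared only
if its log-likelihood ratio exceeds n times the rate. Since the likelihood ratio has mean 1 under
the alternative, Markov's inequality gives the error exponents for any strategy. A wrong guess only
risks failing to stop, which is allowed with probability below ε, so the first phase need not grow
with n. -/

lemma trace_mul_re_nonneg {A B : Matrix (Fin d) (Fin d) ℂ} (hA : A.PosSemidef)
    (hB : B.PosSemidef) : 0 ≤ (A * B).trace.re := by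
  obtain ⟨C, hC⟩ : ∃ C : Matrix (Fin d) (Fin d) ℂ, B = C.conjTranspose * C := by
    open scoped MatrixOrder in
    exact CStarAlgebra.nonneg_iff_eq_star_mul_self.1 hB.nonneg
  have h : (A * B).trace = (C * A * C.conjTranspose).trace := by
    rw [hC, ← Matrix.mul_assoc, Matrix.trace_mul_comm, ← Matrix.mul_assoc]
  rw [h]
  exact (Complex.le_def.1 (hA.mul_mul_conjTranspose_same C).trace_nonneg).1

/-- The spectral decomposition of a Hermitian matrix as a rank-one projective measurement. -/
lemma exists_spectral_pvm {A : Matrix (Fin d) (Fin d) ℂ} (hA : A.IsHermitian) :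
    ∃ m : POVM d (Fin d), m.IsRankOnePVM ∧
      A = ∑ i, (hA.eigenvalues i : ℂ) • m.1 i ∧
      ∀ i j, m.1 i * m.1 j = if i = j then m.1 i else 0 := by
  set U : Matrix (Fin d) (Fin d) ℂ := (hA.eigenvectorUnitary : Matrix (Fin d) (Fin d) ℂ) with hU
  have hUU : star U * U = 1 := Unitary.coe_star_mul_self hA.eigenvectorUnitary
  have hUU' : U * star U = 1 := Unitary.coe_mul_star_self hA.eigenvectorUnitary
  have hunit : IsUnit U := IsUnit.of_mul_eq_one _ hUU'
  have hunit' : IsUnit (star U) := IsUnit.of_mul_eq_one _ hUU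
  let D : Fin d → Matrix (Fin d) (Fin d) ℂ := fun i => Matrix.diagonal (Pi.single i 1)
  have hD : ∀ i j, D i * D j = if i = j then D i else 0 := by
    intro i j
    simp only [D, Matrix.diagonal_mul_diagonal]
    split_ifs with h
    · subst h
      congr 1
      ext k
      by_cases hk : k = i
      · subst hk; simp
      · simp [hk]
    · rw [← Matrix.diagonal_zero]
      congr 1
      ext k
      by_cases hk : k = i
      · subst hk; simp [h]
      · simp [hk]
  have hsum : ∀ f : Fin d → ℂ, ∑ i, f i • D i = Matrix.diagonal f := by
    intro f
    ext k l
    rw [Matrix.sum_apply]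
    by_cases hkl : k = l
    · subst hkl
      simp [D, Pi.single_apply]
    · simp [D, Matrix.diagonal_apply_ne _ hkl]
  have hprod : ∀ i j, U * D i * star U * (U * D j * star U)
      = if i = j then U * D i * star U else 0 := by
    intro i j
    have : U * D i * star U * (U * D j * star U) = U * (D i * D j) * star U := by
      calc _ = U * D i * (star U * U) * D j * star U := by simp only [Matrix.mul_assoc]
        _ = _ := by rw [hUU]; simp only [Matrix.mul_assoc, Matrix.mul_one]
    rw [this, hD]
    split_ifs <;> simp
  refine ⟨⟨fun i => U * D i * star U, fun i => ?_, ?_⟩, fun i => ⟨?_, ?_⟩, ?_, hprod⟩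
  · refine Matrix.PosSemidef.mul_mul_conjTranspose_same (Matrix.PosSemidef.diagonal fun k => ?_) U
    by_cases hk : k = i
    · subst hk; simp
    · simp [hk]
  · rw [← Finset.sum_mul, ← Finset.mul_sum]
    have := hsum 1
    simp only [Pi.one_apply, one_smul] at this
    rw [this]
    change U * Matrix.diagonal (fun _ => 1) * star U = 1
    rw [Matrix.diagonal_one, Matrix.mul_one, hUU']
  · simpa using hprod i i
  · change (U * D i * star U).rank = 1
    rw [Matrix.rank_mul_eq_left_of_isUnit_det _ _ ((Matrix.isUnit_iff_isUnit_det _).1 hunit'),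
      Matrix.rank_mul_eq_right_of_isUnit_det _ _ ((Matrix.isUnit_iff_isUnit_det _).1 hunit),
      Matrix.rank_diagonal]
    rw [Fintype.card_eq_one_iff]
    refine ⟨⟨i, by simp⟩, fun ⟨k, hk⟩ => ?_⟩
    by_contra hne
    exact hk (Pi.single_eq_of_ne (fun h => hne (Subtype.ext h)) 1)
  · conv_lhs => rw [hA.spectral_theorem, Unitary.conjStarAlgAut_apply]
    have := hsum (fun i => (hA.eigenvalues i : ℂ))
    rw [show Matrix.diagonal (RCLike.ofReal ∘ hA.eigenvalues)
      = ∑ i, (hA.eigenvalues i : ℂ) • D i from this.symm]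
    simp only [Finset.mul_sum, Finset.sum_mul, Matrix.mul_smul, Matrix.smul_mul]
    rfl

lemma State.dim_pos (ρ : State d) : 0 < d := by
  rcases Nat.eq_zero_or_pos d with rfl | h
  · have := ρ.2.2
    simp [Matrix.trace] at this
  · exact h

lemma smul_one_eq_sum {N : ℕ} (c : ℂ) (m : POVM d (Fin N)) :
    c • (1 : Matrix (Fin d) (Fin d) ℂ) = ∑ x, c • m.1 x :=
  (congrArg (c • ·) m.2.2.symm).trans Finset.smul_sum

/-- A full-support state dominates a multiple of every state. -/
lemma exists_posSemidef_smul_sub (ρ σ : State d) (hσ : σ.FullSupport) :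
    ∃ C : ℝ, 0 < C ∧ ((C : ℂ) • σ.1 - ρ.1).PosSemidef := by
  have hρH := ρ.2.1.isHermitian
  have hσH : σ.1.IsHermitian := Matrix.PosDef.isHermitian hσ
  have : Nonempty (Fin d) := ⟨⟨0, ρ.dim_pos⟩⟩
  obtain ⟨p, -, hp, -⟩ := exists_spectral_pvm hρH
  obtain ⟨q, -, hq, -⟩ := exists_spectral_pvm hσH
  obtain ⟨i₀, hi₀⟩ := Finite.exists_min hσH.eigenvalues
  obtain ⟨j₀, hj₀⟩ := Finite.exists_max hρH.eigenvalues
  set r := hσH.eigenvalues i₀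
  -- With r the least eigenvalue of σ, r • 1 ≤ σ and ρ ≤ t • 1, so t / r serves as C; the maximum
  -- with 1 only makes t positive at once.
  set t := max (hρH.eigenvalues j₀) 1
  have hr : 0 < r := Matrix.PosDef.eigenvalues_pos hσ i₀
  have ht : 0 < t := lt_max_of_lt_right one_pos
  have h1 : (σ.1 - (r : ℂ) • 1).PosSemidef := by
    have : σ.1 - (r : ℂ) • 1 = ∑ i, ((hσH.eigenvalues i - r : ℝ) : ℂ) • q.1 i := by
      rw [smul_one_eq_sum (r : ℂ) q]
      conv_lhs => rw [hq]
      simp only [← Finset.sum_sub_distrib, ← sub_smul, Complex.ofReal_sub]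
    rw [this]
    refine Matrix.posSemidef_sum _ fun i _ => (q.2.1 i).smul ?_
    exact_mod_cast sub_nonneg.2 (hi₀ i)
  have h2 : ((t : ℂ) • 1 - ρ.1).PosSemidef := by
    have : (t : ℂ) • 1 - ρ.1 = ∑ i, ((t - hρH.eigenvalues i : ℝ) : ℂ) • p.1 i := by
      rw [smul_one_eq_sum (t : ℂ) p]
      conv_lhs => rw [hp]
      simp only [← Finset.sum_sub_distrib, ← sub_smul, Complex.ofReal_sub]
    rw [this]
    refine Matrix.posSemidef_sum _ fun i _ => (p.2.1 i).smul ?_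
    exact_mod_cast sub_nonneg.2 ((hj₀ i).trans (le_max_left _ _))
  refine ⟨t / r, div_pos ht hr, ?_⟩
  have : ((t / r : ℝ) : ℂ) • σ.1 - ρ.1
      = ((t / r : ℝ) : ℂ) • (σ.1 - (r : ℂ) • 1) + ((t : ℂ) • 1 - ρ.1) := by
    rw [smul_sub, smul_smul]
    have : ((t / r : ℝ) : ℂ) * r = t := by
      rw [← Complex.ofReal_mul, div_mul_cancel₀ _ hr.ne']
    rw [this]
    abel
  rw [this]
  refine (h1.smul ?_).add h2
  exact_mod_cast (div_pos ht hr).le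

/-- The constant comes from an operator inequality between the states, so it is uniform in the POVM
and in the number of outcomes. This is what bounds all log-likelihood ratios at once. -/
lemma exists_born_le (ρ σ : State d) (hσ : σ.FullSupport) :
    ∃ C : ℝ, 0 < C ∧ ∀ (N : ℕ) (m : POVM d (Fin N)) (x : Fin N), born ρ m x ≤ C * born σ m x := by
  obtain ⟨C, hC, h⟩ := exists_posSemidef_smul_sub ρ σ hσ
  refine ⟨C, hC, fun N m x => ?_⟩
  have := trace_mul_re_nonneg h (m.2.1 x)
  rw [sub_mul, Matrix.trace_sub, Matrix.smul_mul, Matrix.trace_smul, Complex.sub_re,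
    smul_eq_mul, Complex.re_ofReal_mul] at this
  simp only [born]
  linarith

/-- If `∑ aᵢ mᵢ = ∑ bₓ Mₓ` for a projective measurement `m` and a POVM `M`, then the mean of the
resolvent of the matrix is dominated by the corresponding sum over `M`. -/
lemma resolvent_le {N : ℕ} (ρ : State d) (M : POVM d (Fin N)) (m : POVM d (Fin d))
    (hm : ∀ i j, m.1 i * m.1 j = if i = j then m.1 i else 0) (a : Fin d → ℝ) (b : Fin N → ℝ)
    (ha : ∀ i, 0 < a i) (hb : ∀ x, 0 < b x)
    (hab : ∑ i, (a i : ℂ) • m.1 i = ∑ x, (b x : ℂ) • M.1 x) :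
    ∑ i, born ρ m i / a i ≤ ∑ x, born ρ M x / b x := by
  set G : Matrix (Fin d) (Fin d) ℂ := ∑ i, (((a i)⁻¹ : ℝ) : ℂ) • m.1 i with hG
  have hGH : G.conjTranspose = G := by
    rw [hG, Matrix.conjTranspose_sum]
    refine Finset.sum_congr rfl fun i _ => ?_
    rw [Matrix.conjTranspose_smul, (m.2.1 i).isHermitian.eq]
    simp
  have hAG : (∑ i, (a i : ℂ) • m.1 i) * G = 1 := by
    rw [hG, Finset.sum_mul]
    simp only [Finset.mul_sum, Matrix.smul_mul, Matrix.mul_smul, hm, smul_ite, smul_zero]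
    simp only [Finset.sum_ite_eq, Finset.mem_univ, if_true, smul_smul]
    refine (Finset.sum_congr rfl fun i _ => ?_).trans m.2.2
    rw [← Complex.ofReal_mul, inv_mul_cancel₀ (ha i).ne', Complex.ofReal_one, one_smul]
  -- Completing the square. G is the inverse of A = ∑ b_x M_x, so the cross terms give −2G and the
  -- quadratic term gives GAG = G. Positivity of the left side is the operator Jensen inequality A⁻¹
  -- ≤ ∑ b_x⁻¹ M_x.
  have key : ∑ x, (((b x)⁻¹ : ℝ) : ℂ) •
        ((1 - (b x : ℂ) • G).conjTranspose * M.1 x * (1 - (b x : ℂ) • G))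
      = ∑ x, (((b x)⁻¹ : ℝ) : ℂ) • M.1 x - G := by
    have : ∀ x, (((b x)⁻¹ : ℝ) : ℂ) •
        ((1 - (b x : ℂ) • G).conjTranspose * M.1 x * (1 - (b x : ℂ) • G))
        = (((b x)⁻¹ : ℝ) : ℂ) • M.1 x - G * M.1 x - M.1 x * G + G * ((b x : ℂ) • M.1 x) * G := by
      intro x
      have hbx : (((b x)⁻¹ : ℝ) : ℂ) * (b x : ℂ) = 1 := by
        rw [← Complex.ofReal_mul, inv_mul_cancel₀ (hb x).ne', Complex.ofReal_one]
      rw [Matrix.conjTranspose_sub, Matrix.conjTranspose_smul, hGH, Matrix.conjTranspose_one]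
      simp only [Matrix.sub_mul, Matrix.mul_sub, Matrix.mul_one, smul_sub,
        Matrix.smul_mul, Matrix.mul_smul, smul_smul, Complex.star_def, Complex.conj_ofReal,
        hbx, one_smul, ← mul_assoc, one_mul]
      abel
    simp only [this, Finset.sum_add_distrib, Finset.sum_sub_distrib, ← Finset.mul_sum,
      ← Finset.sum_mul, M.2.2, ← hab]
    rw [mul_assoc, hAG]
    simp
  have hpsd : (∑ x, (((b x)⁻¹ : ℝ) : ℂ) • M.1 x - G).PosSemidef := by
    rw [← key]
    refine Matrix.posSemidef_sum _ fun x _ =>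
      ((M.2.1 x).conjTranspose_mul_mul_same _).smul ?_
    exact_mod_cast (inv_pos.2 (hb x)).le
  have := trace_mul_re_nonneg ρ.2.1 hpsd
  rw [mul_sub, Matrix.trace_sub, Complex.sub_re, hG, Finset.mul_sum, Finset.mul_sum,
    Matrix.trace_sum, Matrix.trace_sum, Complex.re_sum, Complex.re_sum] at this
  simp only [Matrix.mul_smul, Matrix.trace_smul, smul_eq_mul, Complex.re_ofReal_mul] at this
  simp only [born, div_eq_inv_mul]
  linarith

end LinearAlgebra

/-- If the resolvents of one weighted finite family of positive numbers are dominated by those of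
another one of the same mass, then its logarithm dominates. -/
lemma sum_mul_log_le_of_resolvent_le {ι κ : Type*} [Fintype ι] [Fintype κ] (p a : ι → ℝ)
    (q b : κ → ℝ) (ha : ∀ i, 0 < a i) (hb : ∀ x, 0 < b x) (hpq : ∑ i, p i = ∑ x, q x)
    (h : ∀ s : ℝ, 0 ≤ s → ∑ i, p i / (a i + s) ≤ ∑ x, q x / (b x + s)) :
    ∑ x, q x * Real.log (b x) ≤ ∑ i, p i * Real.log (a i) := by
  -- The resolvent inequality says that f is nondecreasing on [0, ∞). Equal masses let log s be
  -- subtracted from every logarithm, so f tends to 0 at infinity, whence f 0 ≤ 0. This replaces the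
  -- integral representation of the logarithm.
  let f : ℝ → ℝ := fun s => ∑ x, q x * Real.log (b x + s) - ∑ i, p i * Real.log (a i + s)
  have hder : ∀ s : ℝ, 0 ≤ s →
      HasDerivAt f (∑ x, q x * (1 / (b x + s)) - ∑ i, p i * (1 / (a i + s))) s := by
    intro s hs
    refine HasDerivAt.sub ?_ ?_
    · exact HasDerivAt.fun_sum fun x _ => (((hasDerivAt_id s).const_add (b x)).log
        (by have := hb x; simp only [id]; positivity)).const_mul (q x)
    · exact HasDerivAt.fun_sum fun x _ => (((hasDerivAt_id s).const_add (a x)).log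
        (by have := ha x; simp only [id]; positivity)).const_mul (p x)
  have hmono : MonotoneOn f (Set.Ici 0) := by
    refine monotoneOn_of_deriv_nonneg (convex_Ici 0)
      (fun s hs => (hder s hs).continuousAt.continuousWithinAt)
      (fun s hs => ((hder s (interior_subset hs)).differentiableAt).differentiableWithinAt)
      fun s hs => ?_
    have hs' : 0 ≤ s := interior_subset hs
    rw [(hder s hs').deriv]
    have := h s hs'
    simp only [mul_one_div]
    linarith
  have hlim1 : ∀ c : ℝ, Tendsto (fun s : ℝ => Real.log (c + s) - Real.log s) atTop (nhds 0) := by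
    intro c
    have h1 : Tendsto (fun s : ℝ => Real.log (c / s + 1)) atTop (nhds 0) := by
      have : Tendsto (fun s : ℝ => c / s + 1) atTop (nhds (0 + 1)) :=
        (tendsto_const_nhds.div_atTop tendsto_id).add_const 1
      rw [zero_add] at this
      have h2 := (Real.continuousAt_log one_ne_zero).tendsto.comp this
      simpa using! h2
    refine h1.congr' ?_
    filter_upwards [eventually_gt_atTop 0, eventually_gt_atTop (-c)] with s hs hs'
    rw [← Real.log_div (by linarith) hs.ne', add_div, div_self hs.ne']
  have hlim : Tendsto f atTop (nhds 0) := by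
    have h1 : Tendsto (fun s : ℝ => ∑ x, q x * (Real.log (b x + s) - Real.log s)
        - ∑ i, p i * (Real.log (a i + s) - Real.log s)) atTop (nhds (0 - 0)) := by
      refine Tendsto.sub ?_ ?_
      · have := tendsto_finsetSum (Finset.univ : Finset κ)
          fun x _ => (hlim1 (b x)).const_mul (q x)
        simpa using this
      · have := tendsto_finsetSum (Finset.univ : Finset ι)
          fun x _ => (hlim1 (a x)).const_mul (p x)
        simpa using this
    rw [sub_zero] at h1
    refine h1.congr fun s => ?_
    simp only [f, mul_sub, Finset.sum_sub_distrib, ← Finset.sum_mul, hpq]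
    ring
  have h0 : f 0 ≤ 0 := by
    refine ge_of_tendsto hlim ?_
    filter_upwards [eventually_ge_atTop 0] with s hs
    exact hmono Set.self_mem_Ici hs hs
  simp only [f, add_zero] at h0
  linarith

/-! ### Log-likelihood ratios -/

section LLR

variable {d N : ℕ}

/-- The log-likelihood ratio of an outcome of a POVM. -/
def llr (ρ σ : State d) (y : POVM d (Fin N) × Fin N) : ℝ :=
  Real.log (born ρ y.1 y.2 / born σ y.1 y.2)

lemma llr_swap (ρ σ : State d) (y : POVM d (Fin N) × Fin N) : llr σ ρ y = -llr ρ σ y := by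
  rw [llr, llr, ← Real.log_inv, inv_div]

lemma measurable_born (ρ : State d) :
    Measurable fun y : POVM d (Fin N) × Fin N => born ρ y.1 y.2 :=
  measurable_from_prod_countable_left fun x => (continuous_born ρ x).measurable

lemma measurable_llr (ρ σ : State d) : Measurable (llr ρ σ : POVM d (Fin N) × Fin N → ℝ) :=
  ((measurable_born ρ).div (measurable_born σ)).log

lemma relEntropy_eq_sum_llr (ρ σ : State d) (m : POVM d (Fin N)) :
    relEntropy (born ρ m) (born σ m) = ∑ x, born ρ m x * llr ρ σ (m, x) := rfl

lemma born_eq_zero_of_born_eq_zero {ρ σ : State d} (hσ : σ.FullSupport) {m : POVM d (Fin N)}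
    {x : Fin N} (h : born σ m x = 0) : born ρ m x = 0 := by
  obtain ⟨C, -, hC⟩ := exists_born_le ρ σ hσ
  have := hC N m x
  rw [h, mul_zero] at this
  exact le_antisymm this (born_nonneg ρ m x)

/-- The likelihood-ratio identity for a single outcome. -/
lemma born_mul_exp_neg_llr {ρ σ : State d} (hρ : ρ.FullSupport) (hσ : σ.FullSupport)
    (m : POVM d (Fin N)) (x : Fin N) :
    born ρ m x * Real.exp (-llr ρ σ (m, x)) = born σ m x := by
  -- Outcomes of probability zero are null under both states, so the default value of the logarithm
  -- there does no harm.
  rcases (born_nonneg ρ m x).eq_or_lt' with h | h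
  · rw [h, zero_mul, born_eq_zero_of_born_eq_zero hρ h]
  rcases (born_nonneg σ m x).eq_or_lt' with h' | h'
  · exact absurd (born_eq_zero_of_born_eq_zero hσ h') h.ne'
  rw [llr, Real.exp_neg, Real.exp_log (div_pos h h'), inv_div, mul_div_cancel₀ _ h.ne']

lemma born_mul_exp_llr {ρ σ : State d} (hρ : ρ.FullSupport) (hσ : σ.FullSupport)
    (m : POVM d (Fin N)) (x : Fin N) :
    born σ m x * Real.exp (llr ρ σ (m, x)) = born ρ m x := by
  rw [← born_mul_exp_neg_llr hσ hρ m x, llr_swap ρ σ, neg_neg]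

/-- The log-likelihood ratios of full-support states are uniformly bounded. -/
lemma exists_abs_llr_le {ρ σ : State d} (hρ : ρ.FullSupport) (hσ : σ.FullSupport) :
    ∃ B : ℝ, 0 < B ∧ ∀ (N : ℕ) (y : POVM d (Fin N) × Fin N), |llr ρ σ y| ≤ B := by
  have key : ∀ {ρ σ : State d}, ρ.FullSupport → σ.FullSupport → ∃ B : ℝ, 0 < B ∧
      ∀ (N : ℕ) (y : POVM d (Fin N) × Fin N), llr ρ σ y ≤ B := by
    intro ρ σ hρ hσ
    obtain ⟨C, hC, h⟩ := exists_born_le ρ σ hσ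
    refine ⟨max (Real.log C) 1, lt_max_of_lt_right one_pos, fun N y => ?_⟩
    rcases (born_nonneg ρ y.1 y.2).eq_or_lt' with h1 | h1
    · rw [llr, h1, zero_div, Real.log_zero]
      exact (lt_max_of_lt_right one_pos).le
    rcases (born_nonneg σ y.1 y.2).eq_or_lt' with h' | h'
    · exact absurd (born_eq_zero_of_born_eq_zero hσ h') h1.ne'
    refine (Real.log_le_log (div_pos h1 h') ?_).trans (le_max_left _ _)
    rw [div_le_iff₀ h']
    exact h N y.1 y.2
  obtain ⟨B, hB, h⟩ := key hρ hσ
  obtain ⟨B', -, h'⟩ := key hσ hρ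
  refine ⟨max B B', lt_max_of_lt_left hB, fun N y =>
    abs_le'.2 ⟨(h N y).trans (le_max_left _ _), ?_⟩⟩
  rw [← llr_swap]
  exact (h' N y).trans (le_max_right _ _)

lemma relEntropy_le_of_abs_llr_le {ρ σ : State d} {B : ℝ} {m : POVM d (Fin N)}
    (hB : ∀ x, |llr ρ σ (m, x)| ≤ B) : relEntropy (born ρ m) (born σ m) ≤ B := by
  rw [relEntropy_eq_sum_llr]
  calc _ ≤ ∑ x, born ρ m x * B := Finset.sum_le_sum fun x _ =>
        mul_le_mul_of_nonneg_left ((le_abs_self _).trans (hB x)) (born_nonneg ρ m x)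
    _ = B := by rw [← Finset.sum_mul, sum_born, one_mul]

/-- Needed because the real supremum in `measuredRelEntropy` would default to 0 for an unbounded
family. -/
lemma bddAbove_relEntropy {ρ σ : State d} (hρ : ρ.FullSupport) (hσ : σ.FullSupport) :
    BddAbove (Set.range fun m : {m : POVM d (Fin d) // m.IsRankOnePVM} =>
      relEntropy (born ρ m.1) (born σ m.1)) := by
  obtain ⟨B, -, hB⟩ := exists_abs_llr_le hρ hσ
  refine ⟨B, ?_⟩
  rintro _ ⟨m, rfl⟩
  exact relEntropy_le_of_abs_llr_le fun x => hB d _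

/-- Gibbs' inequality in variational form. -/
lemma sum_mul_log_le_relEntropy {ρ σ : State d} (hσ : σ.FullSupport) (m : POVM d (Fin N))
    (a : Fin N → ℝ) (ha : ∀ x, 0 < a x) (hsum : ∑ x, born σ m x * a x ≤ 1) :
    ∑ x, born ρ m x * Real.log (a x) ≤ relEntropy (born ρ m) (born σ m) := by
  -- This is log u ≤ u − 1 at u = a q / p, multiplied by p, where p and q are the two outcome
  -- probabilities.
  have h : ∀ x, born ρ m x * Real.log (a x) - born ρ m x * llr ρ σ (m, x)
      ≤ born σ m x * a x - born ρ m x := by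
    intro x
    rcases (born_nonneg ρ m x).eq_or_lt' with h1 | h1
    · rw [h1]
      simpa using mul_nonneg (born_nonneg σ m x) (ha x).le
    rcases (born_nonneg σ m x).eq_or_lt' with h' | h'
    · exact absurd (born_eq_zero_of_born_eq_zero hσ h') h1.ne'
    have hlog := Real.log_le_sub_one_of_pos (div_pos (ha x) (div_pos h1 h'))
    rw [Real.log_div (ha x).ne' (div_pos h1 h').ne'] at hlog
    have := mul_le_mul_of_nonneg_left hlog h1.le
    rw [mul_sub, mul_sub, mul_one] at this
    refine this.trans_eq ?_
    field_simp
  have := Finset.sum_le_sum fun x (_ : x ∈ Finset.univ) => h x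
  rw [Finset.sum_sub_distrib, Finset.sum_sub_distrib, sum_born] at this
  rw [relEntropy_eq_sum_llr]
  linarith

/-- The relative entropy of the outcome distributions of any POVM is at most the measured
relative entropy, which is defined by rank-one projective measurements. -/
theorem relEntropy_le_measuredRelEntropy {ρ σ : State d} (hρ : ρ.FullSupport)
    (hσ : σ.FullSupport) (M : POVM d (Fin N)) :
    relEntropy (born ρ M) (born σ M) ≤ measuredRelEntropy ρ σ := by
  obtain ⟨B, hB, hllr⟩ := exists_abs_llr_le hρ hσ
  -- The likelihood ratios, written as exponentials so that outcomes of probability zero get the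
  -- positive value 1; they carry no weight in the sums against ρ or σ.
  set b : Fin N → ℝ := fun x => Real.exp (llr ρ σ (M, x)) with hb
  have hbpos : ∀ x, 0 < b x := fun x => Real.exp_pos _
  set A : Matrix (Fin d) (Fin d) ℂ := ∑ x, (b x : ℂ) • M.1 x with hA
  -- All b x are at least r = e^{-B}, so A is r • 1 plus a positive semidefinite matrix.
  have hApos : A.PosDef := by
    set r := Real.exp (-B)
    have : A = (r : ℂ) • 1 + ∑ x, ((b x - r : ℝ) : ℂ) • M.1 x := by
      rw [smul_one_eq_sum (r : ℂ) M, ← Finset.sum_add_distrib, hA]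
      refine Finset.sum_congr rfl fun x _ => ?_
      rw [← add_smul, ← Complex.ofReal_add, add_sub_cancel]
    rw [this]
    refine Matrix.PosDef.add_posSemidef (Matrix.PosDef.smul Matrix.PosDef.one ?_)
      (Matrix.posSemidef_sum _ fun x _ => (M.2.1 x).smul ?_)
    · exact_mod_cast Real.exp_pos _
    · exact_mod_cast sub_nonneg.2 (Real.exp_le_exp.2 (neg_le_of_abs_le (hllr N (M, x))))
  obtain ⟨m, hm1, hAm, hmm⟩ := exists_spectral_pvm hApos.isHermitian
  set a := hApos.isHermitian.eigenvalues
  have ha : ∀ i, 0 < a i := hApos.eigenvalues_pos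
  -- Adding s to all b x and all a i adds s • 1 to both expressions of A, so `resolvent_le` applies
  -- at every shift s.
  have h1 : ∑ x, born ρ M x * Real.log (b x) ≤ ∑ i, born ρ m i * Real.log (a i) := by
    refine sum_mul_log_le_of_resolvent_le _ _ _ _ ha hbpos (by rw [sum_born, sum_born])
      fun s hs => ?_
    refine resolvent_le ρ M m hmm _ _ (fun i => by have := ha i; positivity)
      (fun x => by have := hbpos x; positivity) ?_
    simp only [Complex.ofReal_add, add_smul, Finset.sum_add_distrib, ← smul_one_eq_sum]
    rw [← hAm]
  have h2 : ∑ i, born σ m i * a i ≤ 1 := by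
    have e1 : (σ.1 * A).trace.re = ∑ i, born σ m i * a i := by
      conv_lhs => rw [hAm]
      rw [Finset.mul_sum, Matrix.trace_sum, Complex.re_sum]
      refine Finset.sum_congr rfl fun i _ => ?_
      rw [Matrix.mul_smul, Matrix.trace_smul, smul_eq_mul, Complex.re_ofReal_mul, mul_comm, born]
    have e2 : (σ.1 * A).trace.re = ∑ x, born σ M x * b x := by
      rw [hA, Finset.mul_sum, Matrix.trace_sum, Complex.re_sum]
      refine Finset.sum_congr rfl fun i _ => ?_
      rw [Matrix.mul_smul, Matrix.trace_smul, smul_eq_mul, Complex.re_ofReal_mul, mul_comm, born]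
    rw [← e1, e2]
    simp only [hb, born_mul_exp_llr hρ hσ, sum_born, le_refl]
  calc relEntropy (born ρ M) (born σ M) = ∑ x, born ρ M x * Real.log (b x) := by
        simp only [hb, Real.log_exp, relEntropy_eq_sum_llr]
    _ ≤ _ := h1
    _ ≤ _ := sum_mul_log_le_relEntropy hσ m a ha h2
    _ ≤ _ := le_ciSup (bddAbove_relEntropy hρ hσ) ⟨m, hm1⟩

/-- Second-order bound for the moment generating function of the log-likelihood ratio. -/
lemma sum_born_mul_exp_le {ρ σ : State d} {B t : ℝ} {m : POVM d (Fin N)}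
    (hB : ∀ x, |llr ρ σ (m, x)| ≤ B) (ht : |t| * B ≤ 1) :
    ∑ x, born ρ m x * Real.exp (t * llr ρ σ (m, x))
      ≤ Real.exp (t * relEntropy (born ρ m) (born σ m) + t ^ 2 * B ^ 2) := by
  have h : ∀ x, born ρ m x * Real.exp (t * llr ρ σ (m, x))
      ≤ born ρ m x + t * (born ρ m x * llr ρ σ (m, x)) + born ρ m x * (t ^ 2 * B ^ 2) := by
    intro x
    have h1 : |t * llr ρ σ (m, x)| ≤ 1 := by
      rw [abs_mul]
      exact (mul_le_mul_of_nonneg_left (hB x) (abs_nonneg t)).trans ht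
    -- That is, e^u ≤ 1 + u + u² for |u| ≤ 1; the mean is then closed up by 1 + y ≤ e^y.
    have h2 := (abs_le.1 (Real.abs_exp_sub_one_sub_id_le h1)).2
    have h3 : (t * llr ρ σ (m, x)) ^ 2 ≤ t ^ 2 * B ^ 2 := by
      rw [mul_pow]
      exact mul_le_mul_of_nonneg_left (sq_le_sq' (neg_le_of_abs_le (hB x))
        ((le_abs_self _).trans (hB x))) (sq_nonneg t)
    calc _ ≤ born ρ m x * (1 + t * llr ρ σ (m, x) + t ^ 2 * B ^ 2) :=
          mul_le_mul_of_nonneg_left (by linarith) (born_nonneg ρ m x)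
      _ = _ := by ring
  calc _ ≤ _ := Finset.sum_le_sum fun x _ => h x
    _ = t * relEntropy (born ρ m) (born σ m) + t ^ 2 * B ^ 2 + 1 := by
        rw [Finset.sum_add_distrib, Finset.sum_add_distrib, ← Finset.mul_sum, ← Finset.sum_mul,
          sum_born, relEntropy_eq_sum_llr]
        ring
    _ ≤ _ := Real.add_one_le_exp _

/-- Distinct outcome distributions have positive relative entropy. -/
lemma relEntropy_pos {ρ σ : State d} (hσ : σ.FullSupport) {m : POVM d (Fin N)}
    (h : born ρ m ≠ born σ m) : 0 < relEntropy (born ρ m) (born σ m) := by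
  -- Termwise p log (p / q) ≥ p − q, strictly if p ≠ q; the differences p − q sum to zero.
  have hle : ∀ x, born ρ m x - born σ m x ≤ born ρ m x * llr ρ σ (m, x) ∧
      (born ρ m x ≠ born σ m x → born ρ m x - born σ m x < born ρ m x * llr ρ σ (m, x)) := by
    intro x
    rcases (born_nonneg ρ m x).eq_or_lt' with h1 | h1
    · rw [h1, zero_mul, zero_sub]
      have := born_nonneg σ m x
      exact ⟨by linarith, fun h => by have := lt_of_le_of_ne this h; linarith⟩
    rcases (born_nonneg σ m x).eq_or_lt' with h' | h'
    · exact absurd (born_eq_zero_of_born_eq_zero hσ h') h1.ne'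
    have e : born ρ m x * llr ρ σ (m, x)
        = -(born ρ m x * Real.log (born σ m x / born ρ m x)) := by
      rw [← neg_neg (llr ρ σ (m, x)), ← llr_swap, mul_neg, llr]
    have e2 : born ρ m x - born σ m x = -(born ρ m x * (born σ m x / born ρ m x - 1)) := by
      field_simp
      ring
    rw [e, e2]
    refine ⟨neg_le_neg (mul_le_mul_of_nonneg_left
      (Real.log_le_sub_one_of_pos (div_pos h' h1)) h1.le), fun hne => neg_lt_neg
      (mul_lt_mul_of_pos_left (Real.log_lt_sub_one_of_pos (div_pos h' h1) fun h2 => hne ?_) h1)⟩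
    rw [div_eq_one_iff_eq h1.ne'] at h2
    exact h2.symm
  obtain ⟨x, hx⟩ := Function.ne_iff.1 h
  have := Finset.sum_lt_sum (fun x (_ : x ∈ Finset.univ) => (hle x).1)
    ⟨x, Finset.mem_univ x, (hle x).2 hx⟩
  rwa [Finset.sum_sub_distrib, sum_born, sum_born, sub_self] at this

/-- Distinct states are distinguished by some rank-one projective measurement. -/
lemma exists_pvm_born_ne {ρ σ : State d} (hne : ρ ≠ σ) :
    ∃ m : POVM d (Fin d), m.IsRankOnePVM ∧ born ρ m ≠ born σ m := by
  have hH : (ρ.1 - σ.1).IsHermitian := ρ.2.1.isHermitian.sub σ.2.1.isHermitian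
  obtain ⟨m, hm, hA, -⟩ := exists_spectral_pvm hH
  refine ⟨m, hm, fun h => hne (Subtype.ext (sub_eq_zero.1 ?_))⟩
  -- In the eigenbasis of ρ − σ the trace of its square is ∑ λ_i Tr[(ρ − σ) m_i], which vanishes if
  -- the outcome laws agree.
  have h0 : ((ρ.1 - σ.1) * (ρ.1 - σ.1)).trace = 0 := by
    have hre : ((ρ.1 - σ.1) * (ρ.1 - σ.1)).trace.re = 0 := by
      have : (ρ.1 - σ.1) * (ρ.1 - σ.1)
          = ∑ i, (hH.eigenvalues i : ℂ) • ((ρ.1 - σ.1) * m.1 i) := by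
        conv_lhs => arg 2; rw [hA]
        rw [Finset.mul_sum]
        simp only [Matrix.mul_smul]
      rw [this, Matrix.trace_sum, Complex.re_sum]
      refine Finset.sum_eq_zero fun i _ => ?_
      rw [Matrix.trace_smul, smul_eq_mul, Complex.re_ofReal_mul, sub_mul, Matrix.trace_sub,
        Complex.sub_re]
      have := congrFun h i
      simp only [born] at this
      rw [this, sub_self, mul_zero]
    have hnn : 0 ≤ ((ρ.1 - σ.1).conjTranspose * (ρ.1 - σ.1)).trace :=
      (Matrix.posSemidef_conjTranspose_mul_self _).trace_nonneg
    rw [hH.eq] at hnn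
    exact Complex.ext hre (Complex.le_def.1 hnn).2.symm
  nth_rewrite 1 [← hH.eq] at h0
  exact Matrix.trace_conjTranspose_mul_self_eq_zero_iff.1 h0

lemma measuredRelEntropy_pos {ρ σ : State d} (hρ : ρ.FullSupport) (hσ : σ.FullSupport)
    (hne : ρ ≠ σ) : 0 < measuredRelEntropy ρ σ := by
  obtain ⟨m, -, h⟩ := exists_pvm_born_ne hne
  exact (relEntropy_pos hσ h).trans_le (relEntropy_le_measuredRelEntropy hρ hσ m)

lemma exists_lt_relEntropy {ρ σ : State d} (hne : ρ ≠ σ) {R : ℝ}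
    (hR : R < measuredRelEntropy ρ σ) :
    ∃ m : POVM d (Fin d), R < relEntropy (born ρ m) (born σ m) := by
  obtain ⟨m, hm, -⟩ := exists_pvm_born_ne hne
  have : Nonempty {m : POVM d (Fin d) // m.IsRankOnePVM} := ⟨⟨m, hm⟩⟩
  obtain ⟨m, hm⟩ := exists_lt_of_lt_ciSup hR
  exact ⟨m.1, hm⟩

end LLR

/-! ### The law of a sequential test -/

lemma lintegral_bornKernel {d N : ℕ} (ρ : State d) (m : POVM d (Fin N)) (f : Fin N → ℝ≥0∞) :
    ∫⁻ x, f x ∂bornKernel ρ m = ∑ x, ENNReal.ofReal (born ρ m x) * f x := by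
  change ∫⁻ x, f x ∂(∑ x, ENNReal.ofReal (born ρ m x) • Measure.dirac x : Measure (Fin N)) = _
  rw [lintegral_finsetSum_measure]
  refine Finset.sum_congr rfl fun x _ => ?_
  rw [lintegral_smul_measure, lintegral_dirac, smul_eq_mul]

/-- The mean of a function of a POVM and its outcome, for a given law of the POVM. -/
def roundMean {d N : ℕ} (ρ : State d) (μ : Measure (POVM d (Fin N)))
    (f : POVM d (Fin N) × Fin N → ℝ≥0∞) : ℝ≥0∞ :=
  ∫⁻ m, ∑ x, ENNReal.ofReal (born ρ m x) * f (m, x) ∂μ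

lemma measurable_sum_born_mul {d N : ℕ} {α : Type*} [MeasurableSpace α] (ρ : State d)
    {f : α × (POVM d (Fin N) × Fin N) → ℝ≥0∞} (hf : Measurable f) :
    Measurable fun p : α × POVM d (Fin N) =>
      ∑ x, ENNReal.ofReal (born ρ p.2 x) * f (p.1, (p.2, x)) := by
  refine Finset.measurable_fun_sum _ fun x _ => ?_
  exact ((continuous_born ρ x).measurable.ennreal_ofReal.comp measurable_snd).mul
    (hf.comp (by fun_prop))

lemma measurable_sum_born_mul_const {d N : ℕ} (ρ : State d)
    {w : POVM d (Fin N) × Fin N → ℝ≥0∞} (hw : Measurable w) :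
    Measurable fun m : POVM d (Fin N) => ∑ x, ENNReal.ofReal (born ρ m x) * w (m, x) := by
  refine Finset.measurable_fun_sum _ fun x _ => ?_
  have h : Measurable fun m : POVM d (Fin N) => w (m, x) := hw.comp measurable_prodMk_right
  exact (continuous_born ρ x).measurable.ennreal_ofReal.mul h

lemma roundMean_const_mul {d N : ℕ} (ρ : State d) (μ : Measure (POVM d (Fin N))) (c : ℝ≥0∞)
    {w : POVM d (Fin N) × Fin N → ℝ≥0∞} (hw : Measurable w) :
    roundMean ρ μ (fun y => c * w y) = c * roundMean ρ μ w := by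
  rw [roundMean, roundMean, ← lintegral_const_mul _ (measurable_sum_born_mul_const ρ hw)]
  refine lintegral_congr fun m => ?_
  rw [Finset.mul_sum]
  exact Finset.sum_congr rfl fun x _ => mul_left_comm _ _ _

namespace SQHT

variable {d : ℕ} (S : SQHT d)

instance (ρ : State d) : IsProbabilityMeasure (S.law ρ) := by
  unfold law
  infer_instance

/-- The record of the rounds `0, …, k` of a path. -/
def hist (k : ℕ) (ω : S.Path) : History d S.N k := fun j => ω j

lemma measurable_hist (k : ℕ) : Measurable (S.hist k) :=
  measurable_pi_lambda _ fun j => measurable_pi_apply (j : ℕ)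

/-- Restriction of a record to its first rounds. -/
def cut {N j k : ℕ} (h : j ≤ k) (a : History d N k) : History d N j :=
  fun i => a ⟨i, Finset.mem_Iic.2 ((Finset.mem_Iic.1 i.2).trans h)⟩

lemma measurable_cut {N j k : ℕ} (h : j ≤ k) : Measurable (cut (d := d) (N := N) h) :=
  measurable_pi_lambda _ fun _ => measurable_pi_apply _

/-- A record extended by one round. -/
def append {N k : ℕ} (p : History d N k × (POVM d (Fin N) × Fin N)) : History d N (k + 1) :=
  fun i => if h : (i : ℕ) ≤ k then p.1 ⟨i, Finset.mem_Iic.2 h⟩ else p.2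

lemma measurable_append {N k : ℕ} : Measurable (append (d := d) (N := N) (k := k)) := by
  refine measurable_pi_lambda _ fun i => ?_
  by_cases h : (i : ℕ) ≤ k
  · simp only [append, h, dif_pos]
    exact (measurable_pi_apply _).comp measurable_fst
  · simp only [append, h, dif_neg, not_false_iff]
    exact measurable_snd

lemma append_hist (k : ℕ) (ω : S.Path) : append (S.hist k ω, ω (k + 1)) = S.hist (k + 1) ω := by
  funext i
  by_cases h : (i : ℕ) ≤ k
  · simp [append, h, hist]
  · have : (i : ℕ) = k + 1 := le_antisymm (Finset.mem_Iic.1 i.2) (not_le.1 h)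
    simp [append, hist, this]

lemma lintegral_law_zero (ρ : State d) {f : POVM d (Fin S.N) × Fin S.N → ℝ≥0∞}
    (hf : Measurable f) : ∫⁻ ω, f (ω 0) ∂S.law ρ = roundMean ρ S.first f := by
  have hmap : (S.law ρ).map (Preorder.frestrictLe (π := fun _ => POVM d (Fin S.N) × Fin S.N) 0)
      = (S.first ⊗ₘ bornKernel ρ).map (MeasurableEquiv.piUnique
        (fun _ : Finset.Iic 0 => POVM d (Fin S.N) × Fin S.N)).symm := by
    rw [law, Kernel.trajMeasure, Measure.map_comp _ _ (by fun_prop), Kernel.traj_map_frestrictLe,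
      Kernel.partialTraj_self, Measure.id_comp]
  have hf0 : Measurable fun h : History d S.N 0 => f (h ⟨0, by simp⟩) :=
    hf.comp (measurable_pi_apply _)
  have h1 : ∫⁻ ω, f (ω 0) ∂S.law ρ = ∫⁻ h, f (h ⟨0, by simp⟩) ∂((S.law ρ).map
      (Preorder.frestrictLe (π := fun _ => POVM d (Fin S.N) × Fin S.N) 0)) := by
    rw [lintegral_map hf0 (by fun_prop)]
    rfl
  rw [h1, hmap, lintegral_map hf0 (MeasurableEquiv.measurable _)]
  change ∫⁻ a, f a ∂(S.first ⊗ₘ bornKernel ρ) = _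
  rw [Measure.lintegral_compProd hf]
  simp only [lintegral_bornKernel, roundMean]

/-- Conditioning on the rounds `0, …, k`. -/
lemma lintegral_law_succ (ρ : State d) (k : ℕ)
    {f : History d S.N k × (POVM d (Fin S.N) × Fin S.N) → ℝ≥0∞} (hf : Measurable f) :
    ∫⁻ ω, f (S.hist k ω, ω (k + 1)) ∂S.law ρ
      = ∫⁻ ω, roundMean ρ (S.next k (S.hist k ω)) (fun y => f (S.hist k ω, y)) ∂S.law ρ := by
  have hmap := Kernel.map_frestrictLe_trajMeasure_compProd_eq_map_trajMeasure
    (X := fun _ => POVM d (Fin S.N) × Fin S.N) (μ₀ := S.first ⊗ₘ bornKernel ρ)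
    (κ := fun k => S.next k ⊗ₖ (bornKernel ρ).prodMkLeft (History d S.N k)) (a := k)
  have h1 : ∫⁻ ω, f (S.hist k ω, ω (k + 1)) ∂S.law ρ
      = ∫⁻ p, f p ∂((S.law ρ).map fun ω => (S.hist k ω, ω (k + 1))) := by
    rw [lintegral_map hf ((S.measurable_hist k).prodMk (measurable_pi_apply _))]
  have h2 : (S.law ρ).map (fun ω => (S.hist k ω, ω (k + 1)))
      = (S.law ρ).map (S.hist k) ⊗ₘ
        (S.next k ⊗ₖ (bornKernel ρ).prodMkLeft (History d S.N k)) := hmap.symm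
  rw [h1, h2, Measure.lintegral_compProd hf, lintegral_map hf.lintegral_kernel_prod_right'
    (S.measurable_hist k)]
  refine lintegral_congr fun ω => ?_
  rw [Kernel.lintegral_compProd _ _ _ (f := fun y => f (S.hist k ω, y))
    (hf.comp measurable_prodMk_left)]
  simp only [Kernel.prodMkLeft_apply, lintegral_bornKernel, roundMean]

lemma measurable_roundMean_next (ρ : State d) (k : ℕ)
    {f : History d S.N k × (POVM d (Fin S.N) × Fin S.N) → ℝ≥0∞} (hf : Measurable f) :
    Measurable fun h => roundMean ρ (S.next k h) (fun y => f (h, y)) :=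
  (measurable_sum_born_mul ρ hf).lintegral_kernel_prod_right'

/-- The product of a weight over the rounds of a record. -/
def histProd {N k : ℕ} (w : POVM d (Fin N) × Fin N → ℝ≥0∞) (h : History d N k) : ℝ≥0∞ :=
  ∏ i : Fin (k + 1), w (h ⟨i, Finset.mem_Iic.2 (Nat.lt_succ_iff.1 i.2)⟩)

lemma measurable_histProd {N k : ℕ} {w : POVM d (Fin N) × Fin N → ℝ≥0∞} (hw : Measurable w) :
    Measurable (histProd (k := k) w) :=
  Finset.measurable_fun_prod _ fun _ _ => hw.comp (measurable_pi_apply _)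

lemma histProd_hist (k : ℕ) (w : POVM d (Fin S.N) × Fin S.N → ℝ≥0∞) (ω : S.Path) :
    histProd w (S.hist k ω) = ∏ i ∈ Finset.range (k + 1), w (ω i) :=
  (Finset.prod_range fun i => w (ω i)).symm

/-- Change of measure on the rounds `0, …, k`. -/
theorem lintegral_mul_prod_exp_neg_llr {ρ σ : State d} (hρ : ρ.FullSupport) (hσ : σ.FullSupport)
    (k : ℕ) {f : History d S.N k → ℝ≥0∞} (hf : Measurable f) :
    ∫⁻ ω, f (S.hist k ω) * ∏ i ∈ Finset.range (k + 1),
      ENNReal.ofReal (Real.exp (-llr ρ σ (ω i))) ∂S.law ρ = ∫⁻ ω, f (S.hist k ω) ∂S.law σ := by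
  obtain ⟨w, hw⟩ : ∃ w : POVM d (Fin S.N) × Fin S.N → ℝ≥0∞,
      ∀ y, ENNReal.ofReal (Real.exp (-llr ρ σ y)) = w y := ⟨_, fun _ => rfl⟩
  have hwm : Measurable w := by
    rw [← funext hw]
    exact (measurable_llr ρ σ).neg.exp.ennreal_ofReal
  -- The strategy kernels are the same under both states, so only the Born factor of each round is
  -- reweighted.
  have hborn : ∀ (m : POVM d (Fin S.N)) (x : Fin S.N) (c : ℝ≥0∞),
      ENNReal.ofReal (born ρ m x) * (c * w (m, x)) = ENNReal.ofReal (born σ m x) * c := by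
    intro m x c
    rw [mul_left_comm, ← hw, ← ENNReal.ofReal_mul (born_nonneg ρ m x),
      born_mul_exp_neg_llr hρ hσ, mul_comm]
  simp only [hw] at hborn ⊢
  induction k with
  | zero =>
    let e : POVM d (Fin S.N) × Fin S.N → History d S.N 0 := fun y _ => y
    have he : Measurable e := measurable_pi_lambda _ fun _ => measurable_id
    have hhist : ∀ ω : S.Path, S.hist 0 ω = e (ω 0) := by
      intro ω
      funext i
      have : (i : ℕ) = 0 := Nat.le_zero.1 (Finset.mem_Iic.1 i.2)
      simp [hist, e, this]
    simp only [hhist, zero_add, Finset.prod_range_one]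
    rw [S.lintegral_law_zero ρ (f := fun y => f (e y) * w y) ((hf.comp he).mul hwm),
      S.lintegral_law_zero σ (f := fun y => f (e y)) (hf.comp he)]
    simp only [roundMean, hborn]
  | succ k ih =>
    have hfa : Measurable fun p => f (append p) := hf.comp measurable_append
    simp only [Finset.prod_range_succ _ (k + 1), ← append_hist]
    simp only [← S.histProd_hist k w]
    rw [S.lintegral_law_succ ρ k
        (f := fun p => f (append p) * (histProd w p.1 * w p.2)) (hfa.mul
        (((measurable_histProd hwm).comp measurable_fst).mul (hwm.comp measurable_snd))),
      S.lintegral_law_succ σ k (f := fun p => f (append p)) hfa,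
      ← ih (S.measurable_roundMean_next σ k hfa)]
    refine lintegral_congr fun ω => ?_
    rw [← S.histProd_hist k w, roundMean, roundMean, ← lintegral_mul_const _ ?_]
    · refine lintegral_congr fun m => ?_
      rw [Finset.sum_mul]
      refine Finset.sum_congr rfl fun x _ => ?_
      rw [← mul_assoc (f _), hborn, ← mul_assoc]
    · have h : Measurable fun y => f (append (S.hist k ω, y)) :=
        hfa.comp measurable_prodMk_left
      exact measurable_sum_born_mul_const σ h

/-- If a weight has conditional mean at most `c` after the rounds `0, …, j` on the support of a
function `f` of these rounds, then `l` factors of the weight contribute at most `c ^ l`. -/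
theorem lintegral_mul_prod_le (ρ : State d) {w : POVM d (Fin S.N) × Fin S.N → ℝ≥0∞}
    (hw : Measurable w) {c : ℝ≥0∞} {j : ℕ} {f : History d S.N j → ℝ≥0∞} (hf : Measurable f)
    (l : ℕ) (hc : ∀ (k : ℕ) (hjk : j ≤ k), k < j + l → ∀ h : History d S.N k,
      f (cut hjk h) ≠ 0 → roundMean ρ (S.next k h) w ≤ c) :
    ∫⁻ ω, f (S.hist j ω) * ∏ i ∈ Finset.range l, w (ω (j + 1 + i)) ∂S.law ρ
      ≤ c ^ l * ∫⁻ ω, f (S.hist j ω) ∂S.law ρ := by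
  induction l with
  | zero => simp
  | succ l ih =>
    specialize ih fun k hjk hk => hc k hjk (by omega)
    -- All factors but the last are a function of the record up to round j + l, so only the last one
    -- is averaged in the conditioning step.
    let g : History d S.N (j + l) → ℝ≥0∞ := fun h => f (cut (Nat.le_add_right j l) h) *
      ∏ i : Fin l, w (h ⟨j + 1 + i, Finset.mem_Iic.2 (by omega)⟩)
    have hg : Measurable g := (hf.comp (measurable_cut _)).mul
      (Finset.measurable_fun_prod _ fun _ _ => hw.comp (measurable_pi_apply _))
    have hgω : ∀ ω : S.Path, g (S.hist (j + l) ω)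
        = f (S.hist j ω) * ∏ i ∈ Finset.range l, w (ω (j + 1 + i)) := by
      intro ω
      rw [Finset.prod_range]
      rfl
    calc ∫⁻ ω, f (S.hist j ω) * ∏ i ∈ Finset.range (l + 1), w (ω (j + 1 + i)) ∂S.law ρ
        = ∫⁻ ω, g (S.hist (j + l) ω) * w (ω (j + l + 1)) ∂S.law ρ := by
          refine lintegral_congr fun ω => ?_
          rw [hgω, Finset.prod_range_succ, mul_assoc, add_right_comm j l 1]
      _ = ∫⁻ ω, roundMean ρ (S.next (j + l) (S.hist (j + l) ω))
            (fun y => g (S.hist (j + l) ω) * w y) ∂S.law ρ :=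
          S.lintegral_law_succ ρ (j + l) (f := fun p => g p.1 * w p.2)
            ((hg.comp measurable_fst).mul (hw.comp measurable_snd))
      _ ≤ ∫⁻ ω, c * g (S.hist (j + l) ω) ∂S.law ρ := by
          refine lintegral_mono fun ω => ?_
          have h1 : roundMean ρ (S.next (j + l) (S.hist (j + l) ω))
              (fun y => g (S.hist (j + l) ω) * w y)
              = g (S.hist (j + l) ω) * roundMean ρ (S.next (j + l) (S.hist (j + l) ω)) w := by
            exact roundMean_const_mul ρ _ _ hw
          simp only [h1]
          by_cases h0 : f (S.hist j ω) = 0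
          · rw [hgω, h0]
            simp
          · rw [mul_comm]
            gcongr
            exact hc _ (Nat.le_add_right j l) (by omega) _ h0
      _ = c * ∫⁻ ω, f (S.hist j ω) * ∏ i ∈ Finset.range l, w (ω (j + 1 + i)) ∂S.law ρ := by
          simp only [hgω]
          refine lintegral_const_mul _ ?_
          simp only [← hgω]
          exact hg.comp (S.measurable_hist _)
      _ ≤ c * (c ^ l * ∫⁻ ω, f (S.hist j ω) ∂S.law ρ) := by gcongr
      _ = _ := by rw [pow_succ', mul_assoc]

/-- A weight whose mean in each of the first `n` rounds is at most `c` has a product of mean at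
most `c ^ n`. -/
theorem lintegral_prod_le (ρ : State d) {w : POVM d (Fin S.N) × Fin S.N → ℝ≥0∞}
    (hw : Measurable w) {c : ℝ≥0∞} (h0 : roundMean ρ S.first w ≤ c)
    (n : ℕ) (hc : ∀ k < n, ∀ h : History d S.N k, roundMean ρ (S.next k h) w ≤ c) :
    ∫⁻ ω, ∏ i ∈ Finset.range (n + 1), w (ω i) ∂S.law ρ ≤ c ^ (n + 1) := by
  -- The weight of round 0 plays the role of f, as its POVM is drawn from `first` and not from a
  -- kernel.
  have := S.lintegral_mul_prod_le ρ hw (c := c) (j := 0) (f := fun h => w (h ⟨0, by simp⟩))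
    (hw.comp (measurable_pi_apply _)) n (fun k _ hk h _ => hc k (by omega) h)
  calc _ = _ := lintegral_congr fun ω => by
        rw [Finset.prod_range_succ', mul_comm]
        simp only [zero_add, add_comm 1, hist]
    _ ≤ _ := this
    _ ≤ c ^ n * c := by
        gcongr
        exact (S.lintegral_law_zero ρ hw).trans_le h0
    _ = _ := (pow_succ _ _).symm

end SQHT

/-! ### Exponential bounds and the strong converse -/

lemma ennreal_log_ofReal_exp (x : ℝ) : ENNReal.log (ENNReal.ofReal (Real.exp x)) = x := by
  rw [ENNReal.log_ofReal_of_pos (Real.exp_pos x), Real.log_exp]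

/-- Translates rates into explicit exponential bounds. The case p = 0 is included, with infinite
rate. -/
lemma le_log_one_div_div_iff {n : ℕ} (hn : 0 < n) (c : ℝ) (p : ℝ≥0∞) :
    (c : EReal) ≤ ENNReal.log (1 / p) / (n : EReal) ↔
      p ≤ ENNReal.ofReal (Real.exp (-(n * c))) := by
  rw [EReal.le_div_iff_mul_le (by exact_mod_cast hn) (EReal.natCast_ne_top n)]
  have h1 : (c : EReal) * (n : EReal) = ENNReal.log (ENNReal.ofReal (Real.exp (n * c))) := by
    rw [ennreal_log_ofReal_exp, mul_comm]
    push_cast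
    rfl
  rw [h1, ENNReal.log_le_log_iff, one_div, ENNReal.le_inv_iff_le_inv, Real.exp_neg,
    ENNReal.ofReal_inv_of_pos (Real.exp_pos _)]

/-- Markov's inequality for exp X. The restriction to s is there for second-phase estimates, which
hold only after a given first-phase guess. -/
lemma measure_le_of_lintegral_exp_le {Ω : Type*} [MeasurableSpace Ω] (μ : Measure Ω) {X : Ω → ℝ}
    (hX : Measurable X) {s : Set Ω} {a b : ℝ} {C : ℝ≥0∞} (hC : C ≤ ENNReal.ofReal (Real.exp a))
    (h : ∫⁻ ω in s, ENNReal.ofReal (Real.exp (X ω)) ∂μ ≤ C) :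
    μ ({ω | b ≤ X ω} ∩ s) ≤ ENNReal.ofReal (Real.exp (a - b)) := by
  have hm : MeasurableSet {ω | b ≤ X ω} := measurableSet_le measurable_const hX
  rw [← Measure.restrict_apply hm]
  have h1 := mul_meas_ge_le_lintegral (μ := μ.restrict s) hX.exp.ennreal_ofReal
    (ENNReal.ofReal (Real.exp b))
  have h2 : {ω | ENNReal.ofReal (Real.exp b) ≤ ENNReal.ofReal (Real.exp (X ω))}
      = {ω | b ≤ X ω} := by
    ext ω
    simp [ENNReal.ofReal_le_ofReal_iff (Real.exp_pos _).le]
  rw [h2] at h1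
  have h3 := h1.trans (h.trans hC)
  rw [sub_eq_add_neg, Real.exp_add, ENNReal.ofReal_mul (Real.exp_pos _).le, Real.exp_neg,
    ENNReal.ofReal_inv_of_pos (Real.exp_pos _), ← div_eq_mul_inv]
  rw [ENNReal.le_div_iff_mul_le (Or.inl (by simpa using Real.exp_pos b))
    (Or.inl ENNReal.ofReal_ne_top),
    mul_comm]
  exact h3

lemma sum_ofReal_born_mul {d N : ℕ} (ρ : State d) {f : POVM d (Fin N) × Fin N → ℝ}
    (hf : ∀ y, 0 ≤ f y) (m : POVM d (Fin N)) :
    ∑ x, ENNReal.ofReal (born ρ m x) * ENNReal.ofReal (f (m, x))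
      = ENNReal.ofReal (∑ x, born ρ m x * f (m, x)) := by
  rw [ENNReal.ofReal_sum_of_nonneg fun x _ => mul_nonneg (born_nonneg ρ m x) (hf _)]
  exact Finset.sum_congr rfl fun x _ => (ENNReal.ofReal_mul (born_nonneg ρ m x)).symm

lemma roundMean_ofReal_le {d N : ℕ} (ρ : State d) (μ : Measure (POVM d (Fin N)))
    [IsProbabilityMeasure μ] {f : POVM d (Fin N) × Fin N → ℝ} (hf : ∀ y, 0 ≤ f y) {c : ℝ}
    (h : ∀ m, ∑ x, born ρ m x * f (m, x) ≤ c) :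
    roundMean ρ μ (fun y => ENNReal.ofReal (f y)) ≤ ENNReal.ofReal c := by
  simp only [roundMean, sum_ofReal_born_mul ρ hf]
  calc _ ≤ ∫⁻ _, ENNReal.ofReal c ∂μ := lintegral_mono fun m => ENNReal.ofReal_le_ofReal (h m)
    _ = _ := by simp

lemma roundMean_dirac_ofReal {d N : ℕ} (ρ : State d) (m : POVM d (Fin N))
    {f : POVM d (Fin N) × Fin N → ℝ} (hf : ∀ y, 0 ≤ f y) (hfm : Measurable f) :
    roundMean ρ (Measure.dirac m) (fun y => ENNReal.ofReal (f y))
      = ENNReal.ofReal (∑ x, born ρ m x * f (m, x)) := by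
  rw [roundMean, lintegral_dirac' _ (measurable_sum_born_mul_const ρ hfm.ennreal_ofReal),
    sum_ofReal_born_mul ρ hf]

namespace SQHT

variable {d : ℕ} (S : SQHT d)

/-- The log-likelihood ratio of the first `n` rounds. -/
def llrSum (ρ σ : State d) (n : ℕ) (ω : S.Path) : ℝ := ∑ i ∈ Finset.range n, llr ρ σ (ω i)

lemma measurable_llrSum (ρ σ : State d) (n : ℕ) : Measurable (S.llrSum ρ σ n) :=
  Finset.measurable_fun_sum _ fun i _ => (measurable_llr ρ σ).comp (measurable_pi_apply i)

lemma llrSum_swap (ρ σ : State d) (n : ℕ) (ω : S.Path) :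
    S.llrSum σ ρ n ω = -S.llrSum ρ σ n ω := by
  simp only [llrSum, llr_swap ρ σ, Finset.sum_neg_distrib]

lemma prod_ofReal_exp (ρ σ : State d) (t : ℝ) (n : ℕ) (ω : S.Path) :
    ∏ i ∈ Finset.range n, ENNReal.ofReal (Real.exp (t * llr ρ σ (ω i)))
      = ENNReal.ofReal (Real.exp (t * S.llrSum ρ σ n ω)) := by
  rw [llrSum, Finset.mul_sum, Real.exp_sum,
    ENNReal.ofReal_prod_of_nonneg fun _ _ => (Real.exp_pos _).le]

/-- A bound valid for every single POVM survives any random adaptive choice and multiplies over the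
rounds. The sampling state τ is separate because both τ = ρ and τ = σ are needed. -/
lemma lintegral_exp_llrSum_le (ρ σ : State d) (τ : State d) {t c : ℝ}
    (h : ∀ m : POVM d (Fin S.N), ∑ x, born τ m x * Real.exp (t * llr ρ σ (m, x)) ≤ Real.exp c)
    (n : ℕ) :
    ∫⁻ ω, ENNReal.ofReal (Real.exp (t * S.llrSum ρ σ (n + 1) ω)) ∂S.law τ
      ≤ ENNReal.ofReal (Real.exp ((n + 1 : ℕ) * c)) := by
  simp only [← prod_ofReal_exp]
  refine (S.lintegral_prod_le τ (w := fun y => ENNReal.ofReal (Real.exp (t * llr ρ σ y)))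
    (((measurable_llr ρ σ).const_mul t).exp.ennreal_ofReal) (c := ENNReal.ofReal (Real.exp c))
    (roundMean_ofReal_le τ _ (fun _ => (Real.exp_pos _).le) h)
    n (fun k _ a => roundMean_ofReal_le τ _ (fun _ => (Real.exp_pos _).le) h)).trans_eq ?_
  rw [← ENNReal.ofReal_pow (Real.exp_pos _).le, ← Real.exp_nat_mul]

/-- Exponential tail bound for the log-likelihood ratio under any adaptive strategy. -/
theorem measure_le_llrSum {ρ σ : State d} (hρ : ρ.FullSupport) (hσ : σ.FullSupport) {B t : ℝ}
    (hB : ∀ (N : ℕ) (y : POVM d (Fin N) × Fin N), |llr ρ σ y| ≤ B) (ht : 0 ≤ t) (htB : t * B ≤ 1)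
    (c : ℝ) (n : ℕ) :
    S.law ρ {ω | (n + 1 : ℕ) * c ≤ S.llrSum ρ σ (n + 1) ω} ≤ ENNReal.ofReal
      (Real.exp ((n + 1 : ℕ) * (t * measuredRelEntropy ρ σ + t ^ 2 * B ^ 2 - t * c))) := by
  have h := S.lintegral_exp_llrSum_le ρ σ ρ (t := t)
    (c := t * measuredRelEntropy ρ σ + t ^ 2 * B ^ 2) (fun m =>
      (sum_born_mul_exp_le (fun x => hB _ (m, x)) (by rwa [abs_of_nonneg ht])).trans <| by
        gcongr
        exact relEntropy_le_measuredRelEntropy hρ hσ m) n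
  rw [← setLIntegral_univ] at h
  have h2 := measure_le_of_lintegral_exp_le (S.law ρ) ((S.measurable_llrSum ρ σ (n + 1)).const_mul t)
    (b := t * ((n + 1 : ℕ) * c)) le_rfl h
  rw [Set.inter_univ] at h2
  refine (measure_mono fun ω hω => ?_).trans (h2.trans_eq ?_)
  · exact mul_le_mul_of_nonneg_left hω ht
  · congr 2
    ring

/-- Change of measure for events of the first `n + 1` rounds. -/
theorem measure_mul_exp_le {ρ σ : State d} (hρ : ρ.FullSupport) (hσ : σ.FullSupport) (n : ℕ)
    {A : Set (History d S.N n)} (hA : MeasurableSet A) (c : ℝ) :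
    ENNReal.ofReal (Real.exp (-c)) *
        S.law ρ (S.hist n ⁻¹' A ∩ {ω | S.llrSum ρ σ (n + 1) ω < c})
      ≤ S.law σ (S.hist n ⁻¹' A) := by
  have h := S.lintegral_mul_prod_exp_neg_llr hρ hσ n (f := A.indicator 1)
    (measurable_one.indicator hA)
  have h1 : ∫⁻ ω, A.indicator 1 (S.hist n ω) ∂S.law σ = S.law σ (S.hist n ⁻¹' A) :=
    lintegral_indicator_one (S.measurable_hist n hA)
  rw [← h1, ← h]
  have hm : MeasurableSet (S.hist n ⁻¹' A ∩ {ω | S.llrSum ρ σ (n + 1) ω < c}) :=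
    (S.measurable_hist n hA).inter
      (measurableSet_lt (S.measurable_llrSum ρ σ (n + 1)) measurable_const)
  rw [← lintegral_indicator_const hm]
  refine lintegral_mono fun ω => ?_
  have hprod : ∏ i ∈ Finset.range (n + 1), ENNReal.ofReal (Real.exp (-llr ρ σ (ω i)))
      = ENNReal.ofReal (Real.exp (-S.llrSum ρ σ (n + 1) ω)) := by
    have := S.prod_ofReal_exp ρ σ (-1) (n + 1) ω
    simpa only [neg_one_mul] using this
  simp only [hprod]
  by_cases hω : ω ∈ S.hist n ⁻¹' A ∩ {ω | S.llrSum ρ σ (n + 1) ω < c}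
  · have : A.indicator (1 : History d S.N n → ℝ≥0∞) (S.hist n ω) = 1 :=
      Set.indicator_of_mem (show S.hist n ω ∈ A from hω.1) _
    rw [Set.indicator_of_mem hω, this, one_mul]
    exact ENNReal.ofReal_le_ofReal (Real.exp_le_exp.2 (neg_le_neg (le_of_lt hω.2)))
  · rw [Set.indicator_of_notMem hω]
    exact zero_le

/-- The test stops within the first `n` rounds and declares the `i`-th hypothesis. -/
def declaresBy (i : Fin 2) (n : ℕ) : Set S.Path :=
  {ω | ∃ k < n, S.decision k ω = some i ∧ ∀ j < k, S.decision j ω = none}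

lemma numCopies_eq {k : ℕ} {ω : S.Path} (hk : S.decision k ω ≠ none)
    (h : ∀ j < k, S.decision j ω = none) : S.numCopies ω = ((k + 1 : ℕ) : ℕ∞) := by
  refine le_antisymm (iInf₂_le k hk) (le_iInf₂ fun j hj => ?_)
  have : k ≤ j := not_lt.1 fun hlt => hj (h j hlt)
  exact_mod_cast Nat.succ_le_succ this

lemma declaresBy_subset (i : Fin 2) (n : ℕ) : S.declaresBy i n ⊆ S.declares i := by
  rintro ω ⟨k, -, hk, hj⟩
  exact ⟨k, S.numCopies_eq (by simp [hk]) hj, hk⟩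

/-- Only the declaration of i is truncated at time n: it must be an event of finitely many rounds
for the change of measure, while the declaration of j is bounded directly by its error probability.
-/
lemma univ_subset_of_ne {i j : Fin 2} (hij : i ≠ j) (n : ℕ) :
    Set.univ ⊆ {ω | (n : ℕ∞) < S.numCopies ω} ∪ (S.declaresBy i n ∪ S.declares j) := by
  intro ω _
  by_cases h : ∃ k < n, S.decision k ω ≠ none
  · right
    classical
    have h' : ∃ k, k < n ∧ S.decision k ω ≠ none := h
    obtain ⟨h1, h2⟩ := Nat.find_spec h'
    have h3 : ∀ l < Nat.find h', S.decision l ω = none := by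
      intro l hl
      by_contra hne
      exact Nat.find_min h' hl ⟨hl.trans h1, hne⟩
    obtain ⟨a, ha⟩ := Option.ne_none_iff_exists'.1 h2
    rcases (by omega : a = i ∨ a = j) with rfl | rfl
    · exact Or.inl ⟨_, h1, ha, h3⟩
    · exact Or.inr (S.declaresBy_subset a n ⟨_, h1, ha, h3⟩)
  · left
    push Not at h
    have : ((n + 1 : ℕ) : ℕ∞) ≤ S.numCopies ω := by
      refine le_iInf₂ fun k hk => ?_
      have : n ≤ k := not_lt.1 fun hlt => hk (h k hlt)
      exact_mod_cast Nat.succ_le_succ this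
    exact lt_of_lt_of_le (by exact_mod_cast Nat.lt_succ_self n) this

/-- The records of the rounds `0, …, n` for which the test has stopped and declared the `i`-th
hypothesis. -/
def declaresRecords (i : Fin 2) (n : ℕ) : Set (History d S.N n) :=
  {h | ∃ (k : ℕ) (hk : k ≤ n), S.rule k (cut hk h) = some i ∧
    ∀ (j : ℕ) (hj : j < k), S.rule j (cut (hj.le.trans hk) h) = none}

lemma measurableSet_declaresRecords (i : Fin 2) (n : ℕ) :
    MeasurableSet (S.declaresRecords i n) := by
  simp only [declaresRecords, Set.ofPred_exists, Set.ofPred_and, Set.ofPred_forall]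
  refine MeasurableSet.iUnion fun k => MeasurableSet.iUnion fun hk => MeasurableSet.inter ?_
    (MeasurableSet.iInter fun j => MeasurableSet.iInter fun hj => ?_)
  · exact measurable_cut hk (S.measurable_rule k (some i))
  · exact measurable_cut (hj.le.trans hk) (S.measurable_rule j none)

lemma declaresBy_succ (i : Fin 2) (n : ℕ) :
    S.declaresBy i (n + 1) = S.hist n ⁻¹' S.declaresRecords i n := by
  ext ω
  constructor
  · rintro ⟨k, hk, h1, h2⟩
    exact ⟨k, Nat.lt_succ_iff.1 hk, h1, h2⟩
  · rintro ⟨k, hk, h1, h2⟩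
    exact ⟨k, Nat.lt_succ_iff.2 hk, h1, h2⟩

end SQHT

open SQHT in
/-- The strong converse for one of the two error exponents. -/
theorem le_measuredRelEntropy_of_liminf {d : ℕ} {ρ σ : State d} (hρ : ρ.FullSupport)
    (hσ : σ.FullSupport) {i j : Fin 2} (hij : i ≠ j) {ε R R' : ℝ} (hε₁ : ε < 1) (hR' : 0 < R')
    (S : ℕ → SQHT d)
    (hi : (R : EReal) ≤ liminf (fun n : ℕ =>
      ENNReal.log (1 / (S n).law σ ((S n).declares i)) / (n : EReal)) atTop)
    (hj : (R' : EReal) ≤ liminf (fun n : ℕ =>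
      ENNReal.log (1 / (S n).law ρ ((S n).declares j)) / (n : EReal)) atTop)
    (hT : ∀ᶠ n in atTop,
      (S n).law ρ {ω | (n : ℕ∞) < (S n).numCopies ω} ≤ ENNReal.ofReal ε) :
    R ≤ measuredRelEntropy ρ σ := by
  by_contra! hlt
  set D := measuredRelEntropy ρ σ
  obtain ⟨c, hDc, hcR⟩ := exists_between hlt
  obtain ⟨c', hcc', hcR'⟩ := exists_between hcR
  obtain ⟨B, hB0, hB⟩ := exists_abs_llr_le hρ hσ
  obtain ⟨t, ht0, htB, htc⟩ : ∃ t : ℝ, 0 < t ∧ t * B ≤ 1 ∧ t * D + t ^ 2 * B ^ 2 - t * c < 0 := by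
    -- With t B² ≤ (c − D) / 2 the exponent t (D + t B² − c) is at most −t (c − D) / 2.
    refine ⟨min (1 / B) ((c - D) / (2 * B ^ 2)), ?_, ?_, ?_⟩
    · have : 0 < c - D := sub_pos.2 hDc
      positivity
    · rw [← le_div_iff₀ hB0]
      exact min_le_left _ _
    · set t := min (1 / B) ((c - D) / (2 * B ^ 2))
      have hcD : 0 < c - D := sub_pos.2 hDc
      have ht : 0 < t := by positivity
      have h2 : t * (2 * B ^ 2) ≤ c - D := by
        rw [← le_div_iff₀ (by positivity)]
        exact min_le_right _ _
      have : t * (D + t * B ^ 2 - c) < 0 := mul_neg_of_pos_of_neg ht (by nlinarith)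
      linarith
  set a := t * D + t ^ 2 * B ^ 2 - t * c with ha
  have hexp : ∀ b : ℝ, b < 0 → Tendsto (fun n : ℕ => Real.exp (n * b)) atTop (nhds 0) := by
    intro b hb
    exact Real.tendsto_exp_atBot.comp (tendsto_natCast_atTop_atTop.atTop_mul_const_of_neg hb)
  have hε : max ε 0 < 1 := max_lt hε₁ one_pos
  -- Three events of probability at most η each, together with non-stopping, must fall short of
  -- total mass 1.
  set η := (1 - max ε 0) / 4 with hη
  have hη0 : 0 < η := by rw [hη]; linarith
  have e1 := (hexp a htc).eventually (gt_mem_nhds hη0)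
  have e2 := (hexp (-(R' / 2)) (by linarith)).eventually (gt_mem_nhds hη0)
  have e3 := (hexp (c - c') (by linarith)).eventually (gt_mem_nhds hη0)
  have e4 := eventually_lt_of_lt_liminf
    (lt_of_lt_of_le (EReal.coe_lt_coe_iff.2 hcR') hi)
  have e5 := eventually_lt_of_lt_liminf
    (lt_of_lt_of_le (EReal.coe_lt_coe_iff.2 (half_lt_self hR')) hj)
  obtain ⟨n, e1, e2, e3, e4, e5, e6, hn⟩ :=
    (e1.and (e2.and (e3.and (e4.and (e5.and (hT.and (eventually_gt_atTop 0))))))).exists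
  obtain ⟨l, rfl⟩ : ∃ l, n = l + 1 := ⟨n - 1, (Nat.succ_pred_eq_of_pos hn).symm⟩
  have b4 := (le_log_one_div_div_iff hn _ _).1 e4.le
  have b5 := (le_log_one_div_div_iff hn _ _).1 e5.le
  set T := S (l + 1)
  have hcov : (1 : ℝ≥0∞) ≤ T.law ρ {ω | ((l + 1 : ℕ) : ℕ∞) < T.numCopies ω}
      + (T.law ρ (T.declaresBy i (l + 1)) + T.law ρ (T.declares j)) := by
    rw [← measure_univ (μ := T.law ρ)]
    exact (measure_mono (T.univ_subset_of_ne hij (l + 1))).trans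
      ((measure_union_le _ _).trans (add_le_add_right (measure_union_le _ _) _))
  have hsplit : T.law ρ (T.declaresBy i (l + 1)) ≤
      T.law ρ (T.declaresBy i (l + 1) ∩ {ω | T.llrSum ρ σ (l + 1) ω < (l + 1 : ℕ) * c})
      + T.law ρ {ω | (l + 1 : ℕ) * c ≤ T.llrSum ρ σ (l + 1) ω} := by
    refine (measure_mono fun ω hω => ?_).trans (measure_union_le _ _)
    rcases lt_or_ge (T.llrSum ρ σ (l + 1) ω) ((l + 1 : ℕ) * c) with h | h
    · exact Or.inl ⟨hω, h⟩
    · exact Or.inr h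
  have htail := T.measure_le_llrSum hρ hσ hB ht0.le htB c l
  have hcm := T.measure_mul_exp_le hρ hσ l (T.measurableSet_declaresRecords i l) ((l + 1 : ℕ) * c)
  rw [← declaresBy_succ] at hcm
  have hcm' := hcm.trans ((measure_mono (T.declaresBy_subset i (l + 1))).trans b4)
  set p := T.law ρ (T.declaresBy i (l + 1) ∩ {ω | T.llrSum ρ σ (l + 1) ω < (l + 1 : ℕ) * c})
  have hp : p ≤ ENNReal.ofReal η := by
    -- Undoing the density factor costs e^{nc}, while the error under σ is at most e^{-nc'}; hence
    -- the choice c < c' < R.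
    have h1 : p = ENNReal.ofReal (Real.exp ((l + 1 : ℕ) * c)) *
        (ENNReal.ofReal (Real.exp (-((l + 1 : ℕ) * c))) * p) := by
      rw [← mul_assoc, ← ENNReal.ofReal_mul (Real.exp_pos _).le, ← Real.exp_add, add_neg_cancel,
        Real.exp_zero, ENNReal.ofReal_one, one_mul]
    rw [h1]
    refine (mul_le_mul_right hcm' _).trans ?_
    rw [← ENNReal.ofReal_mul (Real.exp_pos _).le, ← Real.exp_add]
    refine ENNReal.ofReal_le_ofReal (le_of_eq_of_le ?_ e3.le)
    congr 1
    ring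
  have hfin : (1 : ℝ≥0∞) ≤ ENNReal.ofReal (max ε 0)
      + ((ENNReal.ofReal η + ENNReal.ofReal η) + ENNReal.ofReal η) := by
    refine hcov.trans (add_le_add (e6.trans (ENNReal.ofReal_le_ofReal (le_max_left _ _)))
      (add_le_add (hsplit.trans (add_le_add hp (htail.trans ?_))) (b5.trans ?_)))
    · exact ENNReal.ofReal_le_ofReal e1.le
    · refine ENNReal.ofReal_le_ofReal (le_of_eq_of_le ?_ e2.le)
      congr 1
      ring
  rw [← ENNReal.ofReal_add hη0.le hη0.le, ← ENNReal.ofReal_add (by linarith) hη0.le,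
    ← ENNReal.ofReal_add (le_max_right _ _) (by linarith), ENNReal.one_le_ofReal] at hfin
  rw [hη] at hfin
  linarith

/-! ### Achievability by two-phase tests -/

/-- The log-likelihood ratio of a record. -/
def recSum {d N k : ℕ} (ρ σ : State d) (h : History d N k) : ℝ :=
  ∑ i : Fin (k + 1), llr ρ σ (h ⟨i, Finset.mem_Iic.2 (Nat.lt_succ_iff.1 i.2)⟩)

lemma measurable_recSum {d N k : ℕ} (ρ σ : State d) :
    Measurable (recSum ρ σ : History d N k → ℝ) :=
  Finset.measurable_fun_sum _ fun _ _ => (measurable_llr ρ σ).comp (measurable_pi_apply _)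

/-- For small t the exponent is tD − t²B², with D the relative entropy of the outcome laws, so the
decay per unit of t comes arbitrarily close to D and beats R. At R = 0 it gives a positive rate for
the first phase. -/
lemma exists_chernoff {d N : ℕ} {ρ σ : State d} (hρ : ρ.FullSupport) (hσ : σ.FullSupport)
    (m : POVM d (Fin N)) {R : ℝ} (hR : R < relEntropy (born ρ m) (born σ m)) :
    ∃ t φ : ℝ, 0 < t ∧ t * R < φ ∧
      ∑ x, born ρ m x * Real.exp (-t * llr ρ σ (m, x)) ≤ Real.exp (-φ) := by
  obtain ⟨B, hB0, hB⟩ := exists_abs_llr_le hρ hσ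
  set D := relEntropy (born ρ m) (born σ m)
  have hDR : 0 < D - R := sub_pos.2 hR
  set t := min (1 / B) ((D - R) / (2 * B ^ 2))
  have ht : 0 < t := by positivity
  have htB : t * B ≤ 1 := by
    rw [← le_div_iff₀ hB0]
    exact min_le_left _ _
  have h2 : t * (2 * B ^ 2) ≤ D - R := by
    rw [← le_div_iff₀ (by positivity)]
    exact min_le_right _ _
  refine ⟨t, t * D - t ^ 2 * B ^ 2, ht, ?_, ?_⟩
  · have : t * (R + t * B ^ 2 - D) < 0 := mul_neg_of_pos_of_neg ht (by nlinarith)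
    linarith
  · refine (sum_born_mul_exp_le (fun x => hB N (m, x))
      (by rwa [abs_neg, abs_of_pos ht])).trans_eq ?_
    congr 1
    ring

namespace SQHT

variable {d : ℕ}

/-! ### Exponential estimates for the log-likelihood ratio -/

section General

variable (S : SQHT d)

lemma recSum_hist (ρ σ : State d) (k : ℕ) (ω : S.Path) :
    recSum ρ σ (S.hist k ω) = S.llrSum ρ σ (k + 1) ω :=
  (Finset.sum_range fun i => llr ρ σ (ω i)).symm

/-- Under the alternative, a large log-likelihood ratio is exponentially unlikely, whatever the
strategy. -/
theorem measure_le_llrSum_of_alternative {ρ σ : State d} (hρ : ρ.FullSupport)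
    (hσ : σ.FullSupport) (n : ℕ) (R : ℝ) :
    S.law σ {ω | (n + 1 : ℕ) * R ≤ S.llrSum ρ σ (n + 1) ω}
      ≤ ENNReal.ofReal (Real.exp (-((n + 1 : ℕ) * R))) := by
  -- At t = 1 the weight is the likelihood ratio itself, which has mean 1 under σ for each POVM.
  have h := S.lintegral_exp_llrSum_le ρ σ σ (t := 1) (c := 0) (fun m => by
    simp only [one_mul, born_mul_exp_llr hρ hσ, sum_born, Real.exp_zero, le_refl]) n
  simp only [one_mul, mul_zero] at h
  rw [← setLIntegral_univ] at h
  have h2 := measure_le_of_lintegral_exp_le (S.law σ) (S.measurable_llrSum ρ σ (n + 1))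
    (b := (n + 1 : ℕ) * R) le_rfl h
  rwa [Set.inter_univ, zero_sub] at h2

variable {ρ σ : State d} {c a : POVM d (Fin S.N)} {j : ℕ}

/-- Chernoff bound for a wrong guess: the first j + 1 rounds all measure c, so each contributes a
factor of at most e^{-γ}. -/
lemma measure_llrSum_nonpos_le (hfirst : S.first = Measure.dirac c)
    (hnext : ∀ k < j, ∀ h, S.next k h = Measure.dirac c) {s γ : ℝ} (hs : 0 ≤ s)
    (hc : ∑ x, born ρ c x * Real.exp (-s * llr ρ σ (c, x)) ≤ Real.exp (-γ)) :
    S.law ρ {ω | S.llrSum ρ σ (j + 1) ω ≤ 0}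
      ≤ ENNReal.ofReal (Real.exp (-((j + 1 : ℕ) * γ))) := by
  have hm : Measurable fun y : POVM d (Fin S.N) × Fin S.N => Real.exp (-s * llr ρ σ y) :=
    ((measurable_llr ρ σ).const_mul (-s)).exp
  have hdirac : roundMean ρ (Measure.dirac c)
      (fun y => ENNReal.ofReal (Real.exp (-s * llr ρ σ y))) ≤ ENNReal.ofReal (Real.exp (-γ)) := by
    rw [roundMean_dirac_ofReal ρ c (fun _ => (Real.exp_pos _).le) hm]
    exact ENNReal.ofReal_le_ofReal hc
  have h := S.lintegral_prod_le ρ hm.ennreal_ofReal (hfirst ▸ hdirac) j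
    (fun k hk a => by rw [hnext k hk]; exact hdirac)
  simp only [prod_ofReal_exp] at h
  rw [← setLIntegral_univ, ← ENNReal.ofReal_pow (Real.exp_pos _).le, ← Real.exp_nat_mul] at h
  have h2 := measure_le_of_lintegral_exp_le (S.law ρ)
    ((S.measurable_llrSum ρ σ (j + 1)).const_mul (-s)) (b := 0) le_rfl h
  rw [Set.inter_univ, sub_zero, mul_neg] at h2
  refine (measure_mono fun ω hω => ?_).trans h2
  exact mul_nonneg_of_nonpos_of_nonpos (neg_nonpos.2 hs) hω

/-- After a correct guess the first phase contributes a nonnegative log-likelihood ratio and can be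
dropped; each of the l later rounds gives a factor of at most e^{-φ}. -/
lemma measure_llrSum_le_inter_le {E : Set (History d S.N j)} (hE : MeasurableSet E)
    (hE0 : ∀ ω : S.Path, S.hist j ω ∈ E → 0 ≤ S.llrSum ρ σ (j + 1) ω)
    (hnext : ∀ (k : ℕ) (hk : j ≤ k) (h : History d S.N k), cut hk h ∈ E →
      S.next k h = Measure.dirac a) {t φ : ℝ} (ht : 0 ≤ t)
    (ha : ∑ x, born ρ a x * Real.exp (-t * llr ρ σ (a, x)) ≤ Real.exp (-φ)) (l : ℕ) (b : ℝ) :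
    S.law ρ ({ω | S.llrSum ρ σ (j + 1 + l) ω ≤ b} ∩ S.hist j ⁻¹' E)
      ≤ ENNReal.ofReal (Real.exp (t * b - l * φ)) := by
  have hm : Measurable fun y : POVM d (Fin S.N) × Fin S.N => Real.exp (-t * llr ρ σ y) :=
    ((measurable_llr ρ σ).const_mul (-t)).exp
  set w : POVM d (Fin S.N) × Fin S.N → ℝ≥0∞ :=
    fun y => ENNReal.ofReal (Real.exp (-t * llr ρ σ y)) with hw
  -- The first-phase part of the exponential weight, cut off to E; there it is at most 1 because the
  -- ratio is nonnegative.
  let f : History d S.N j → ℝ≥0∞ := E.indicator (histProd w)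
  have hf : Measurable f := (measurable_histProd hm.ennreal_ofReal).indicator hE
  have h := S.lintegral_mul_prod_le ρ (w := w) hm.ennreal_ofReal
    (c := ENNReal.ofReal (Real.exp (-φ))) hf l (fun k hk _ h hne => by
      rw [hnext k hk h (Set.mem_of_indicator_ne_zero hne),
        roundMean_dirac_ofReal ρ a (fun _ => (Real.exp_pos _).le) hm]
      exact ENNReal.ofReal_le_ofReal ha)
  have hf1 : ∫⁻ ω, f (S.hist j ω) ∂S.law ρ ≤ 1 := by
    calc _ ≤ ∫⁻ _, 1 ∂S.law ρ := by
          refine lintegral_mono fun ω => ?_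
          by_cases hω : S.hist j ω ∈ E
          · simp only [f, Set.indicator_of_mem hω, histProd_hist, hw, prod_ofReal_exp]
            rw [ENNReal.ofReal_le_one, Real.exp_le_one_iff]
            exact mul_nonpos_of_nonpos_of_nonneg (neg_nonpos.2 ht) (hE0 ω hω)
          · simp [f, Set.indicator_of_notMem hω]
      _ = 1 := by simp
  have hint : ∫⁻ ω in S.hist j ⁻¹' E,
      ENNReal.ofReal (Real.exp (-t * S.llrSum ρ σ (j + 1 + l) ω)) ∂S.law ρ
      ≤ ENNReal.ofReal (Real.exp (l * (-φ))) := by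
    rw [← lintegral_indicator (S.measurable_hist j hE)]
    calc _ = _ := ?_
      _ ≤ _ := h.trans (mul_le_of_le_one_right' hf1)
      _ = _ := by rw [← ENNReal.ofReal_pow (Real.exp_pos _).le, ← Real.exp_nat_mul]
    refine lintegral_congr fun ω => ?_
    by_cases hω : S.hist j ω ∈ E
    · rw [Set.indicator_of_mem (show ω ∈ S.hist j ⁻¹' E from hω)]
      simp only [f, Set.indicator_of_mem hω, histProd_hist]
      rw [← prod_ofReal_exp, Finset.prod_range_add]
    · rw [Set.indicator_of_notMem (show ω ∉ S.hist j ⁻¹' E from hω)]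
      simp [f, Set.indicator_of_notMem hω]
  have h2 := measure_le_of_lintegral_exp_le (S.law ρ)
    ((S.measurable_llrSum ρ σ (j + 1 + l)).const_mul (-t)) (b := -t * b) le_rfl hint
  refine (measure_mono (Set.inter_subset_inter_left _ fun ω hω => ?_)).trans (h2.trans_eq ?_)
  · exact mul_le_mul_of_nonpos_left hω (neg_nonpos.2 ht)
  · congr 2
    ring

/-- A strategy that measures `c` in the first `j + 1` rounds and `a` afterwards if the record of
these rounds is in `E`, i.e. favours `ρ`, makes the log-likelihood ratio grow under `ρ`. -/
theorem measure_llrSum_le_le {E : Set (History d S.N j)} (hE : MeasurableSet E)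
    (hE0 : ∀ ω : S.Path, S.hist j ω ∈ E → 0 ≤ S.llrSum ρ σ (j + 1) ω)
    (hE1 : ∀ ω : S.Path, S.hist j ω ∉ E → S.llrSum ρ σ (j + 1) ω ≤ 0)
    (hfirst : S.first = Measure.dirac c)
    (hnext : ∀ k < j, ∀ h, S.next k h = Measure.dirac c)
    (hnextE : ∀ (k : ℕ) (hk : j ≤ k) (h : History d S.N k), cut hk h ∈ E →
      S.next k h = Measure.dirac a) {s γ t φ : ℝ} (hs : 0 ≤ s)
    (hc : ∑ x, born ρ c x * Real.exp (-s * llr ρ σ (c, x)) ≤ Real.exp (-γ)) (ht : 0 ≤ t)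
    (ha : ∑ x, born ρ a x * Real.exp (-t * llr ρ σ (a, x)) ≤ Real.exp (-φ)) (l : ℕ) (b : ℝ) :
    S.law ρ {ω | S.llrSum ρ σ (j + 1 + l) ω ≤ b}
      ≤ ENNReal.ofReal (Real.exp (-((j + 1 : ℕ) * γ)))
        + ENNReal.ofReal (Real.exp (t * b - l * φ)) := by
  refine le_trans ?_ (add_le_add (S.measure_llrSum_nonpos_le hfirst hnext hs hc)
    (S.measure_llrSum_le_inter_le hE hE0 hnextE ht ha l b))
  refine (measure_mono fun ω hω => ?_).trans (measure_union_le _ _)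
  by_cases h : S.hist j ω ∈ E
  · exact Or.inr ⟨hω, h⟩
  · exact Or.inl (hE1 ω h)

end General

/-! ### Construction of the two-phase test -/

section TwoPhase

variable {N : ℕ} (c a b : POVM d (Fin N)) {j : ℕ} (E : Set (History d N j))

open Classical in
/-- The measurement of round `k + 1` of the two-phase strategy. -/
def choice (k : ℕ) (h : History d N k) : POVM d (Fin N) :=
  if hk : j ≤ k then if cut hk h ∈ E then a else b else c

lemma measurable_choice (hE : MeasurableSet E) (k : ℕ) : Measurable (choice c a b E k) := by
  classical
  by_cases hk : j ≤ k
  · have : choice c a b E k = fun h => if cut hk h ∈ E then a else b :=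
      funext fun h => dif_pos hk
    rw [this]
    exact Measurable.ite (measurable_cut hk hE) measurable_const measurable_const
  · have : choice c a b E k = fun _ => c := funext fun h => dif_neg hk
    rw [this]
    exact measurable_const

open Classical in
/-- The two-phase test: the POVM `c` is measured in the rounds `0, …, j`, and afterwards `a` or `b`
according to whether the record of these rounds is in `E`; the decision is taken after round `l`
according to whether the record is in `A₁` or in `A₀`. -/
def twoPhase (hE : MeasurableSet E) (l : ℕ) (A₀ A₁ : Set (History d N l))
    (hA₀ : MeasurableSet A₀) (hA₁ : MeasurableSet A₁) : SQHT d where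
  N := N
  first := Measure.dirac c
  isProb_first := inferInstance
  next k := Kernel.deterministic (choice c a b E k) (measurable_choice c a b E hE k)
  isMarkov_next _ := inferInstance
  -- An undecided record makes the test run forever, so doubt counts as late stopping and not as an
  -- error.
  rule k h := if hk : k = l then
    if cut hk.ge h ∈ A₁ then some 1 else if cut hk.ge h ∈ A₀ then some 0 else none else none
  measurable_rule k v := by
    by_cases hk : k = l
    · simp only [hk, dif_pos]
      let : MeasurableSpace (Option (Fin 2)) := ⊤
      exact (Measurable.ite (measurable_cut hk.ge hA₁) measurable_const
        (Measurable.ite (measurable_cut hk.ge hA₀) measurable_const measurable_const))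
        (MeasurableSpace.measurableSet_top (s := {v}))
    · simp only [hk, dif_neg, not_false_iff]
      exact MeasurableSet.preimage (MeasurableSpace.measurableSet_top (s := {v})) measurable_const

variable {l : ℕ} {A₀ A₁ : Set (History d N l)} {hE : MeasurableSet E}
  {hA₀ : MeasurableSet A₀} {hA₁ : MeasurableSet A₁}

lemma twoPhase_next (k : ℕ) (h : History d N k) :
    (twoPhase c a b E hE l A₀ A₁ hA₀ hA₁).next k h = Measure.dirac (choice c a b E k h) :=
  Kernel.deterministic_apply (measurable_choice c a b E hE k) h

open Classical in
lemma twoPhase_decision (k : ℕ) (ω : (twoPhase c a b E hE l A₀ A₁ hA₀ hA₁).Path) :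
    (twoPhase c a b E hE l A₀ A₁ hA₀ hA₁).decision k ω = if k = l then
      if (twoPhase c a b E hE l A₀ A₁ hA₀ hA₁).hist l ω ∈ A₁ then some 1
      else if (twoPhase c a b E hE l A₀ A₁ hA₀ hA₁).hist l ω ∈ A₀ then some 0 else none
      else none := by
  by_cases hk : k = l
  · subst hk
    rw [if_pos rfl]
    exact dif_pos rfl
  · rw [if_neg hk]
    exact dif_neg hk

lemma twoPhase_declares_one_subset :
    (twoPhase c a b E hE l A₀ A₁ hA₀ hA₁).declares 1 ⊆
      (twoPhase c a b E hE l A₀ A₁ hA₀ hA₁).hist l ⁻¹' A₁ := by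
  rintro ω ⟨k, -, hk⟩
  rw [twoPhase_decision] at hk
  split_ifs at hk with h1 h2 h3
  · exact h2
  · simp at hk

lemma twoPhase_declares_zero_subset :
    (twoPhase c a b E hE l A₀ A₁ hA₀ hA₁).declares 0 ⊆
      (twoPhase c a b E hE l A₀ A₁ hA₀ hA₁).hist l ⁻¹' A₀ := by
  rintro ω ⟨k, -, hk⟩
  rw [twoPhase_decision] at hk
  split_ifs at hk with h1 h2 h3
  · simp at hk
  · exact h3

lemma twoPhase_lt_numCopies {ω : (twoPhase c a b E hE l A₀ A₁ hA₀ hA₁).Path}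
    (h : ((l + 1 : ℕ) : ℕ∞) < (twoPhase c a b E hE l A₀ A₁ hA₀ hA₁).numCopies ω) :
    (twoPhase c a b E hE l A₀ A₁ hA₀ hA₁).hist l ω ∉ A₁ ∧
      (twoPhase c a b E hE l A₀ A₁ hA₀ hA₁).hist l ω ∉ A₀ := by
  have hnone : (twoPhase c a b E hE l A₀ A₁ hA₀ hA₁).decision l ω = none := by
    by_contra hne
    exact absurd h (not_lt.2 (iInf₂_le l hne))
  rw [twoPhase_decision, if_pos rfl] at hnone
  split_ifs at hnone with h1 h2
  exact ⟨h1, h2⟩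

end TwoPhase

end SQHT

/-- Only i = l − j rounds measure the good POVM while the threshold counts l + 1 rounds; the j + 1
missing ones cost the constant factor e^{tR(j+1)}, which the gap φ − tR absorbs. -/
lemma eventually_exp_sub_le {t R φ η : ℝ} (h : t * R < φ) (hη : 0 < η) (j : ℕ) :
    ∀ᶠ l : ℕ in atTop, ∀ i : ℕ, j + 1 + i = l + 1 →
      Real.exp (t * ((l + 1 : ℕ) * R) - i * φ) ≤ η := by
  have h1 : Tendsto (fun i : ℕ => Real.exp (t * R * (j + 1) + i * (t * R - φ))) atTop (nhds 0) :=
    Real.tendsto_exp_atBot.comp (tendsto_const_nhds.add_atBot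
      (tendsto_natCast_atTop_atTop.atTop_mul_const_of_neg (sub_neg.2 h)))
  obtain ⟨M, hM⟩ := eventually_atTop.1 (h1.eventually (gt_mem_nhds hη))
  filter_upwards [eventually_ge_atTop (M + j)] with l hl i hi
  refine le_of_eq_of_le ?_ (hM i (by omega)).le
  rw [← hi]
  push_cast
  congr 1
  ring

open SQHT in
/-- Rates below the measured relative entropies are achievable. -/
theorem isAchievableProb_of_lt {d : ℕ} {ρ₀ ρ₁ : State d} (h₀ : ρ₀.FullSupport)
    (h₁ : ρ₁.FullSupport) (hne : ρ₀ ≠ ρ₁) {ε : ℝ} (hε : 0 < ε) {R : ℝ × ℝ} (hR₀ : 0 < R.1)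
    (hR₁ : 0 < R.2) (hlt₀ : R.1 < measuredRelEntropy ρ₁ ρ₀)
    (hlt₁ : R.2 < measuredRelEntropy ρ₀ ρ₁) : IsAchievableProb ε ρ₀ ρ₁ R := by
  obtain ⟨c, -, hc⟩ := exists_pvm_born_ne hne
  obtain ⟨a, ha⟩ := exists_lt_relEntropy hne.symm hlt₀
  obtain ⟨b, hb⟩ := exists_lt_relEntropy hne hlt₁
  obtain ⟨s₁, γ₁, hs₁, hγ₁, hc₁⟩ := exists_chernoff h₁ h₀ c (relEntropy_pos h₀ hc.symm)
  obtain ⟨s₀, γ₀, hs₀, hγ₀, hc₀⟩ := exists_chernoff h₀ h₁ c (relEntropy_pos h₁ hc)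
  obtain ⟨t₁, φ₁, ht₁, hφ₁, ha₁⟩ := exists_chernoff h₁ h₀ a ha
  obtain ⟨t₀, φ₀, ht₀, hφ₀, hb₀⟩ := exists_chernoff h₀ h₁ b hb
  rw [mul_zero] at hγ₁ hγ₀
  have hη : 0 < ε / 4 := by linarith
  have hphase : ∀ γ : ℝ, 0 < γ →
      ∀ᶠ j : ℕ in atTop, Real.exp (-((j + 1 : ℕ) * γ)) ≤ ε / 4 := by
    intro γ hγ
    have h1 : Tendsto (fun j : ℕ => Real.exp ((j : ℝ) * -γ)) atTop (nhds 0) :=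
      Real.tendsto_exp_atBot.comp
        (tendsto_natCast_atTop_atTop.atTop_mul_const_of_neg (neg_neg_of_pos hγ))
    filter_upwards [((tendsto_add_atTop_iff_nat 1).2 h1).eventually (gt_mem_nhds hη)] with j hj
    rw [← mul_neg]
    exact hj.le
  -- The length of the first phase depends on ε but not on l, so it leaves the asymptotic rates
  -- unchanged.
  obtain ⟨j, hj₁, hj₀⟩ := ((hphase γ₁ hγ₁).and (hphase γ₀ hγ₀)).exists
  let E : Set (History d d j) := {h | 0 ≤ recSum ρ₁ ρ₀ h}
  have hE : MeasurableSet E := measurableSet_le measurable_const (measurable_recSum ρ₁ ρ₀)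
  let A₁ : (l : ℕ) → Set (History d d l) := fun l => {h | (l + 1 : ℕ) * R.1 ≤ recSum ρ₁ ρ₀ h}
  let A₀ : (l : ℕ) → Set (History d d l) := fun l => {h | (l + 1 : ℕ) * R.2 ≤ recSum ρ₀ ρ₁ h}
  have hA₁ : ∀ l, MeasurableSet (A₁ l) := fun l =>
    measurableSet_le measurable_const (measurable_recSum ρ₁ ρ₀)
  have hA₀ : ∀ l, MeasurableSet (A₀ l) := fun l =>
    measurableSet_le measurable_const (measurable_recSum ρ₀ ρ₁)
  let S : ℕ → SQHT d := fun l => twoPhase c a b E hE l (A₀ l) (A₁ l) (hA₀ l) (hA₁ l)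
  have hd₁ : ∀ l, (S l).law ρ₀ ((S l).declares 1)
      ≤ ENNReal.ofReal (Real.exp (-((l + 1 : ℕ) * R.1))) := fun l =>
    (measure_mono fun ω hω => by
      have h := twoPhase_declares_one_subset c a b E hω
      change (l + 1 : ℕ) * R.1 ≤ recSum ρ₁ ρ₀ ((S l).hist l ω) at h
      rwa [recSum_hist] at h).trans ((S l).measure_le_llrSum_of_alternative h₁ h₀ l R.1)
  have hd₀ : ∀ l, (S l).law ρ₁ ((S l).declares 0)
      ≤ ENNReal.ofReal (Real.exp (-((l + 1 : ℕ) * R.2))) := fun l =>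
    (measure_mono fun ω hω => by
      have h := twoPhase_declares_zero_subset c a b E hω
      change (l + 1 : ℕ) * R.2 ≤ recSum ρ₀ ρ₁ ((S l).hist l ω) at h
      rwa [recSum_hist] at h).trans ((S l).measure_le_llrSum_of_alternative h₀ h₁ l R.2)
  have hfirst : ∀ l, (S l).first = Measure.dirac c := fun l => rfl
  have hnext : ∀ l, ∀ k < j, ∀ h, (S l).next k h = Measure.dirac c := by
    intro l k hk h
    exact (twoPhase_next c a b E k h).trans (congrArg Measure.dirac (dif_neg (not_le.2 hk)))
  have hnext₁ : ∀ (l k : ℕ) (hk : j ≤ k) (h : History d d k), cut hk h ∈ E →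
      (S l).next k h = Measure.dirac a := by
    intro l k hk h hh
    exact (twoPhase_next c a b E k h).trans (congrArg Measure.dirac ((dif_pos hk).trans (if_pos hh)))
  have hnext₀ : ∀ (l k : ℕ) (hk : j ≤ k) (h : History d d k), cut hk h ∈ Eᶜ →
      (S l).next k h = Measure.dirac b := by
    intro l k hk h hh
    exact (twoPhase_next c a b E k h).trans (congrArg Measure.dirac ((dif_pos hk).trans (if_neg hh)))
  have hEiff : ∀ l (ω : (S l).Path), (S l).hist j ω ∈ E ↔
      0 ≤ (S l).llrSum ρ₁ ρ₀ (j + 1) ω := by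
    intro l ω
    change 0 ≤ recSum ρ₁ ρ₀ ((S l).hist j ω) ↔ _
    rw [recSum_hist]
  have hstop₁ : ∀ᶠ l in atTop,
      (S l).law ρ₁ {ω | ((l + 1 : ℕ) : ℕ∞) < (S l).numCopies ω} ≤ ENNReal.ofReal (ε / 2) := by
    filter_upwards [eventually_exp_sub_le hφ₁ hη j, eventually_ge_atTop j] with l hl hjl
    obtain ⟨i, hi⟩ : ∃ i, j + 1 + i = l + 1 := ⟨l - j, by omega⟩
    have h := (S l).measure_llrSum_le_le (ρ := ρ₁) (σ := ρ₀) (c := c) (a := a) hE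
      (fun ω hω => (hEiff l ω).1 hω) (fun ω hω => (not_le.1 fun h => hω ((hEiff l ω).2 h)).le)
      (hfirst l) (hnext l) (hnext₁ l) hs₁.le hc₁ ht₁.le ha₁ i ((l + 1 : ℕ) * R.1)
    rw [hi] at h
    refine (measure_mono fun ω hω => ?_).trans (h.trans ((add_le_add
      (ENNReal.ofReal_le_ofReal hj₁) (ENNReal.ofReal_le_ofReal (hl i hi))).trans_eq ?_))
    · have h := (twoPhase_lt_numCopies c a b E hω).1
      change ¬ (l + 1 : ℕ) * R.1 ≤ recSum ρ₁ ρ₀ ((S l).hist l ω) at h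
      rw [recSum_hist] at h
      exact (not_le.1 h).le
    · rw [← ENNReal.ofReal_add hη.le hη.le]
      congr 1
      ring
  have hstop₀ : ∀ᶠ l in atTop,
      (S l).law ρ₀ {ω | ((l + 1 : ℕ) : ℕ∞) < (S l).numCopies ω} ≤ ENNReal.ofReal (ε / 2) := by
    filter_upwards [eventually_exp_sub_le hφ₀ hη j, eventually_ge_atTop j] with l hl hjl
    obtain ⟨i, hi⟩ : ∃ i, j + 1 + i = l + 1 := ⟨l - j, by omega⟩
    have h := (S l).measure_llrSum_le_le (ρ := ρ₀) (σ := ρ₁) (c := c) (a := b) hE.compl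
      (fun ω hω => by
        rw [(S l).llrSum_swap ρ₁]
        exact neg_nonneg.2 (not_le.1 fun h => hω ((hEiff l ω).2 h)).le)
      (fun ω hω => by
        rw [(S l).llrSum_swap ρ₁]
        exact neg_nonpos.2 ((hEiff l ω).1 (not_not.1 hω)))
      (hfirst l) (hnext l) (hnext₀ l) hs₀.le hc₀ ht₀.le hb₀ i ((l + 1 : ℕ) * R.2)
    rw [hi] at h
    refine (measure_mono fun ω hω => ?_).trans (h.trans ((add_le_add
      (ENNReal.ofReal_le_ofReal hj₀) (ENNReal.ofReal_le_ofReal (hl i hi))).trans_eq ?_))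
    · have h := (twoPhase_lt_numCopies c a b E hω).2
      change ¬ (l + 1 : ℕ) * R.2 ≤ recSum ρ₀ ρ₁ ((S l).hist l ω) at h
      rw [recSum_hist] at h
      exact (not_le.1 h).le
    · rw [← ENNReal.ofReal_add hη.le hη.le]
      congr 1
      ring
  -- Rounds are counted from 0: a decision after round n − 1 uses n copies. The value at n = 0 is
  -- irrelevant.
  refine ⟨hR₀, hR₁, fun n => S (n - 1), ?_, ?_, ?_⟩
  · refine le_liminf_of_le (by isBoundedDefault) ?_
    filter_upwards [eventually_gt_atTop 0] with n hn
    obtain ⟨l, rfl⟩ : ∃ l, n = l + 1 := ⟨n - 1, (Nat.succ_pred_eq_of_pos hn).symm⟩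
    exact (le_log_one_div_div_iff hn _ _).2 (hd₁ l)
  · refine le_liminf_of_le (by isBoundedDefault) ?_
    filter_upwards [eventually_gt_atTop 0] with n hn
    obtain ⟨l, rfl⟩ : ∃ l, n = l + 1 := ⟨n - 1, (Nat.succ_pred_eq_of_pos hn).symm⟩
    exact (le_log_one_div_div_iff hn _ _).2 (hd₀ l)
  · refine lt_of_le_of_lt (limsup_le_of_le (a := ENNReal.ofReal (ε / 2)) (by isBoundedDefault) ?_)
      ((ENNReal.ofReal_lt_ofReal_iff hε).2 (half_lt_self hε))
    obtain ⟨M, hM⟩ := eventually_atTop.1 (hstop₁.and hstop₀)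
    filter_upwards [eventually_gt_atTop M] with n hn
    obtain ⟨l, rfl⟩ : ∃ l, n = l + 1 := ⟨n - 1, by omega⟩
    obtain ⟨h1, h0⟩ := hM l (by omega)
    exact max_le h0 h1

/-- The strong converse is used twice with the states exchanged; each use relies on the other rate
being positive, which rules out tests that always declare the same hypothesis. -/
theorem isAchievableProb_le {d : ℕ} {ρ₀ ρ₁ : State d} (h₀ : ρ₀.FullSupport)
    (h₁ : ρ₁.FullSupport) {ε : ℝ} (hε₁ : ε < 1) {R : ℝ × ℝ} (h : IsAchievableProb ε ρ₀ ρ₁ R) :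
    R.1 ≤ measuredRelEntropy ρ₁ ρ₀ ∧ R.2 ≤ measuredRelEntropy ρ₀ ρ₁ := by
  obtain ⟨hR₀, hR₁, S, hα, hβ, hT⟩ := h
  have hev := eventually_lt_of_limsup_lt hT
  exact ⟨le_measuredRelEntropy_of_liminf h₁ h₀ (i := 1) (j := 0) (by decide) hε₁ hR₁ S hα hβ
      (hev.mono fun n hn => ((le_max_right _ _).trans_lt hn).le),
    le_measuredRelEntropy_of_liminf h₀ h₁ (i := 0) (j := 1) (by decide) hε₁ hR₀ S hβ hα
      (hev.mono fun n hn => ((le_max_left _ _).trans_lt hn).le)⟩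

end QuantumSHT

end

theorem theorem3 {d : ℕ} (ρ₀ ρ₁ : QuantumSHT.State d)
    (h₀ : ρ₀.FullSupport) (h₁ : ρ₁.FullSupport) (hne : ρ₀ ≠ ρ₁)
    (ε : ℝ) (hε₀ : 0 < ε) (hε₁ : ε < 1) :
    QuantumSHT.regionProb ε ρ₀ ρ₁ =
      Set.Icc 0 (QuantumSHT.measuredRelEntropy ρ₁ ρ₀) ×ˢ
        Set.Icc 0 (QuantumSHT.measuredRelEntropy ρ₀ ρ₁) := by
  refine Set.Subset.antisymm (closure_minimal (fun R hR => ?_) (isClosed_Icc.prod isClosed_Icc)) ?_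
  · have := QuantumSHT.isAchievableProb_le h₀ h₁ hε₁ hR
    exact ⟨⟨hR.1.le, this.1⟩, ⟨hR.2.1.le, this.2⟩⟩
  -- Both measured relative entropies are positive as the states differ, so the closed rectangle is
  -- the closure of the open one, all of whose points are achievable.
  · rw [← closure_Ioo (QuantumSHT.measuredRelEntropy_pos h₁ h₀ hne.symm).ne,
      ← closure_Ioo (QuantumSHT.measuredRelEntropy_pos h₀ h₁ hne).ne, ← closure_prod_eq]
    exact closure_mono fun R hR => QuantumSHT.isAchievableProb_of_lt h₀ h₁ hne hε₀
      hR.1.1 hR.2.1 hR.1.2 hR.2.2
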